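/- Let $d\ge 2$ and $N\ge 1$ be integers, let $U\in\mathcal U_d$ be a unitary matrix and let $\delta\in[0,1]$. For a unitary $V$ of dimension $D$ with columns $|v_1\rangle,\dots,|v_D\rangle$ let $\mathcal P_V(\rho)=\sum_{i=1}^{D}\langle v_i|\rho|v_i\rangle\,|i\rangle\langle i|$ be the corresponding von Neumann measurement, regarded as a channel on $D\times D$ matrices. Consider the certification of $H_0:\mathcal P_{\mathbb 1^{\otimes N}}\otimes \mathrm{id}$ against $H_1:\mathcal P_{U^{\otimes N}}\otimes \mathrm{id}$, where $\mathrm{id}$ acts on an auxiliary system of arbitrary finite dimension. A strategy consists of such an auxiliary dimension, a unit vector $|\psi\rangle$ of the joint system and an effect $0\le\Omega\le \mathbb 1$, and the minimized probability of the type II error is $$p_{\mathrm{II}}^{(N)}=\min\Big\{\operatorname{tr}\big(\Omega\,(\mathcal P_{U^{\otimes N}}\otimes \mathrm{id})(|\psi\rangle\langle\psi|)\big)\ :\ \operatorname{tr}\big((\mathbb 1-\Omega)\,(\mathcal P_{\mathbb 1^{\otimes N}}\otimes \mathrm{id})(|\psi\rangle\langle\psi|)\big)\le\delta\Big\},$$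 the minimum being taken over all strategies. For a square matrix $X$ of size at least $2$ and $q\in\mathbb C$ with $|q|\le1$ let $$W_q(X)=\{\langle\psi|X|\varphi\rangle:\ \langle\psi|\psi\rangle=\langle\varphi|\varphi\rangle=1,\ \langle\psi|\varphi\rangle=q\},\qquad \nu_q(X)=\min\{|x|:x\in W_q(X)\}.$$ Then the minimum defining $p_{\mathrm{II}}^{(N)}$ and the maximum below are attained, and $$p_{\mathrm{II}}^{(N)}=\max_{E}\ \nu_{\sqrt{1-\delta}}^{2}\big(U^{\otimes N}E^{\otimes N}\big),$$ where $E$ ranges over the diagonal unitary matrices of dimension $d$. -/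

import Mathlib

open scoped Matrix ComplexOrder

noncomputable section

namespace QuantumCertification

/-- A vector `ψ` is a (normalized) pure state: `⟨ψ|ψ⟩ = 1`. -/
def IsPureState {n : Type*} [Fintype n] (ψ : n → ℂ) : Prop :=
  star ψ ⬝ᵥ ψ = 1

/-- The rank-one operator `|ψ⟩⟨ψ|`. -/
def proj {n : Type*} (ψ : n → ℂ) : Matrix n n ℂ :=
  Matrix.vecMulVec ψ (star ψ)

/-- The von Neumann measurement `P_V`, as the channel
`ρ ↦ ∑ i, ⟨v_i| ρ |v_i⟩ |i⟩⟨i|`, where `v_i` is the `i`-th column of `V`. -/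
def vonNeumann {n : Type*} [Fintype n] [DecidableEq n] (V : Matrix n n ℂ)
    (ρ : Matrix n n ℂ) : Matrix n n ℂ :=
  Matrix.diagonal fun i => star (V.col i) ⬝ᵥ (ρ *ᵥ V.col i)

/-- The extension `Φ ⊗ id` of a map `Φ` on `n × n` matrices by the identity on an auxiliary
system indexed by `κ`: `Φ` is applied to each block `(X_{(i,a),(j,b)})_{i,j}`. -/
def tensorId {n : Type*} (κ : Type*) (Φ : Matrix n n ℂ → Matrix n n ℂ)
    (X : Matrix (n × κ) (n × κ) ℂ) : Matrix (n × κ) (n × κ) ℂ :=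
  Matrix.of fun p q => Φ (Matrix.of fun i j => X (i, p.2) (j, q.2)) p.1 q.1

/-- `Ω` is an effect of the two-outcome measurement `{Ω, 1 - Ω}`, that is `0 ≤ Ω ≤ 1`. -/
def IsEffect {m : Type*} [DecidableEq m] (Ω : Matrix m m ℂ) : Prop :=
  Ω.PosSemidef ∧ (1 - Ω).PosSemidef

/-- Type I error `tr ((1 - Ω) (Φ₀ ⊗ id)(|ψ⟩⟨ψ|))` of the strategy `(ψ, Ω)`. -/
def typeIError {n κ : Type*} [Fintype n] [Fintype κ] [DecidableEq n] [DecidableEq κ]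
    (Φ₀ : Matrix n n ℂ → Matrix n n ℂ) (ψ : n × κ → ℂ)
    (Ω : Matrix (n × κ) (n × κ) ℂ) : ℝ :=
  (Matrix.trace ((1 - Ω) * tensorId κ Φ₀ (proj ψ))).re

/-- Type II error `tr (Ω (Φ₁ ⊗ id)(|ψ⟩⟨ψ|))` of the strategy `(ψ, Ω)`. -/
def typeIIError {n κ : Type*} [Fintype n] [Fintype κ]
    (Φ₁ : Matrix n n ℂ → Matrix n n ℂ) (ψ : n × κ → ℂ)
    (Ω : Matrix (n × κ) (n × κ) ℂ) : ℝ :=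
  (Matrix.trace (Ω * tensorId κ Φ₁ (proj ψ))).re

/-- All type II errors of strategies certifying `H₀ : Φ₀ ⊗ id` against `H₁ : Φ₁ ⊗ id` with
type I error at most `δ`. A strategy consists of an auxiliary system of any finite dimension
`k`, an input state `ψ` and an effect `Ω` (accepting `H₀`). -/
def achievableTypeIIErrors {n : Type*} [Fintype n] [DecidableEq n]
    (Φ₀ Φ₁ : Matrix n n ℂ → Matrix n n ℂ) (δ : ℝ) : Set ℝ :=
  {p | ∃ (k : ℕ) (ψ : n × Fin k → ℂ) (Ω : Matrix (n × Fin k) (n × Fin k) ℂ),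
    IsPureState ψ ∧ IsEffect Ω ∧ typeIError Φ₀ ψ Ω ≤ δ ∧ p = typeIIError Φ₁ ψ Ω}

/-- `p` is the minimized probability of the type II error `p_II` for certifying
`H₀ : Φ₀ ⊗ id` against `H₁ : Φ₁ ⊗ id` with statistical significance `δ`. -/
def IsMinTypeIIError {n : Type*} [Fintype n] [DecidableEq n]
    (Φ₀ Φ₁ : Matrix n n ℂ → Matrix n n ℂ) (δ p : ℝ) : Prop :=
  IsLeast (achievableTypeIIErrors Φ₀ Φ₁ δ) p

/-- The `q`-numerical range
`W_q(X) = {⟨ψ|X|φ⟩ : ⟨ψ|ψ⟩ = ⟨φ|φ⟩ = 1, ⟨ψ|φ⟩ = q}`. -/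
def qNumericalRange {n : Type*} [Fintype n] (q : ℂ) (X : Matrix n n ℂ) : Set ℂ :=
  {z | ∃ ψ φ : n → ℂ, IsPureState ψ ∧ IsPureState φ ∧ star ψ ⬝ᵥ φ = q ∧
    z = star ψ ⬝ᵥ (X *ᵥ φ)}

/-- `ν_q(X) = min {|x| : x ∈ W_q(X)}`; the minimum exists by `isLeast_nu`. -/
def nu {n : Type*} [Fintype n] (q : ℂ) (X : Matrix n n ℂ) : ℝ :=
  sInf ((fun z : ℂ => ‖z‖) '' qNumericalRange q X)

/-- The tensor power `A^{⊗N}` in the product basis, indexed by `N`-tuples. -/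
def tensorPower {d : ℕ} (A : Matrix (Fin d) (Fin d) ℂ) (N : ℕ) :
    Matrix (Fin N → Fin d) (Fin N → Fin d) ℂ :=
  Matrix.of fun i j => ∏ k, A (i k) (j k)

/-- The diagonal unitary matrices of size `d`. -/
def diagonalUnitaries (d : ℕ) : Set (Matrix (Fin d) (Fin d) ℂ) :=
  {E | E ∈ Matrix.unitaryGroup (Fin d) ℂ ∧ E.IsDiag}

/-! Facts showing that the minimum in the definition of `nu` exists. -/

theorem isPureState_iff {n : Type*} [Fintype n] (ψ : n → ℂ) :
    IsPureState ψ ↔ ∑ i, ‖ψ i‖ ^ 2 = 1 := by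
  have h : star ψ ⬝ᵥ ψ = ((∑ i, ‖ψ i‖ ^ 2 : ℝ) : ℂ) := by
    simp [dotProduct, Complex.conj_mul']
  rw [IsPureState, h]
  exact_mod_cast Iff.rfl

theorem isCompact_qNumericalRange {n : Type*} [Fintype n] (q : ℂ) (X : Matrix n n ℂ) :
    IsCompact (qNumericalRange q X) := by
  have hb : ∀ ψ : n → ℂ, IsPureState ψ → ‖ψ‖ ≤ 1 := by
    intro ψ hψ
    rw [isPureState_iff] at hψ
    rw [pi_norm_le_iff_of_nonneg zero_le_one]
    intro i
    have h := Finset.single_le_sum (f := fun i => ‖ψ i‖ ^ 2)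
      (fun i _ => sq_nonneg _) (Finset.mem_univ i)
    simp only [hψ] at h
    exact (sq_le_one_iff₀ (norm_nonneg _)).1 h
  let K : Set ((n → ℂ) × (n → ℂ)) :=
    {p | star p.1 ⬝ᵥ p.1 = 1 ∧ star p.2 ⬝ᵥ p.2 = 1 ∧ star p.1 ⬝ᵥ p.2 = q}
  have hclosed : IsClosed K := by
    refine IsClosed.and ?_ (IsClosed.and ?_ ?_) <;>
    · refine isClosed_eq ?_ continuous_const
      unfold dotProduct
      fun_prop
  have hK : IsCompact K := by
    refine (isCompact_closedBall (0 : (n → ℂ) × (n → ℂ)) 1).of_isClosed_subset hclosed ?_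
    rintro ⟨ψ, φ⟩ ⟨h1, h2, -⟩
    rw [mem_closedBall_zero_iff, Prod.norm_def]
    exact max_le (hb ψ h1) (hb φ h2)
  have himg : qNumericalRange q X = (fun p => star p.1 ⬝ᵥ (X *ᵥ p.2)) '' K := by
    ext z
    constructor
    · rintro ⟨ψ, φ, h1, h2, h3, rfl⟩
      exact ⟨(ψ, φ), ⟨h1, h2, h3⟩, rfl⟩
    · rintro ⟨⟨ψ, φ⟩, ⟨h1, h2, h3⟩, rfl⟩
      exact ⟨ψ, φ, h1, h2, h3, rfl⟩
  rw [himg]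
  refine hK.image ?_
  unfold Matrix.mulVec dotProduct
  fun_prop

theorem qNumericalRange_nonempty {n : Type*} [Fintype n] [Nontrivial n] {q : ℂ}
    (hq : ‖q‖ ≤ 1) (X : Matrix n n ℂ) : (qNumericalRange q X).Nonempty := by
  classical
  obtain ⟨a, b, hab⟩ := exists_pair_ne n
  have hs : 0 ≤ 1 - ‖q‖ ^ 2 := by nlinarith [norm_nonneg q]
  refine ⟨_, Pi.single a (star q) + Pi.single b ((Real.sqrt (1 - ‖q‖ ^ 2) : ℝ) : ℂ),
    Pi.single a 1, ?_, ?_, ?_, rfl⟩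
  · rw [IsPureState, star_add, Pi.star_single, Pi.star_single]
    simp only [add_dotProduct, dotProduct_add, single_dotProduct, Pi.single_eq_same,
      Pi.single_eq_of_ne hab, Pi.single_eq_of_ne hab.symm, star_star]
    simp only [mul_zero, add_zero, zero_add, RCLike.star_def, Complex.mul_conj',
      Complex.conj_ofReal]
    norm_cast
    rw [Real.mul_self_sqrt hs]
    ring
  · simp [IsPureState, Pi.star_single]
  · rw [star_add, Pi.star_single, Pi.star_single, add_dotProduct, single_dotProduct,
      single_dotProduct]
    simp [Pi.single_eq_of_ne hab.symm]

theorem isLeast_nu {n : Type*} [Fintype n] [Nontrivial n] {q : ℂ} (hq : ‖q‖ ≤ 1)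
    (X : Matrix n n ℂ) : IsLeast ((fun z : ℂ => ‖z‖) '' qNumericalRange q X) (nu q X) :=
  ((isCompact_qNumericalRange q X).image continuous_norm).isLeast_sInf
    ((qNumericalRange_nonempty hq X).image _)

end QuantumCertification

end

/-!
Write `V = U E` for a diagonal unitary `E`, `q = √(1 - δ)`, and let `ρ` be the marginal of the input
state `ψ` on the measured system.

*Lower bound on the errors.* The output of a measurement is block diagonal and does not see the
phases of its columns, so for every diagonal unitary `E` the two errors of a strategy are those of
a block-diagonal effect that has to tell `ψ` from `(V† ⊗ 1) ψ` (`typeIError_eq`, `typeIIError_eq`).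
The overlap of these two vectors is `tr (ρ V)`, a convex combination of eigenvalues of `V`, hence a
point of the numerical range of `V`. Both the best error for two pure states of overlap `c` and the
smallest modulus `|⟨ψ|V|φ⟩|` over `φ` with `⟨ψ|φ⟩ = q`, where `c = |⟨ψ|V|ψ⟩|`, are expressed through
`q c - √(1 - q²) √(1 - c²)`; so `ν_q(V)²` is a lower bound for the type II error of every strategy
(`nu_sq_le_of_mem_achievable`). This holds in particular for `E^{⊗N}` in place of `E`.

*A strategy attaining the bound.* For one copy, let `v` be the minimum of `∑ i, |(ρ U) i i|` over
density matrices. If `v = 0`, a minimizer and its tensor powers discriminate perfectly. If `v > 0`,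
separating the set of all `diag (ρ U)` from the `ℓ¹`-ball of radius `v` gives a diagonal
contraction, and its phases give a diagonal unitary `E` such that every eigenvalue of `V = U E` has
real part at least `v = cos θ`. Complementary slackness then yields eigenstates `ρ₁`, `ρ₂` of `V`
for the extreme eigenvalues `exp (± i θ)` with equal diagonals (`perfect_or_exists_eigenstates`).

For `N` copies, products of `ρ₁` and `ρ₂` all have the same diagonal and are eigenstates of
`V^{⊗N}` for the eigenvalues `exp (i (2 j - N) θ)`. If `N θ ≥ π / 2`, a mixture of them makes
`diag (ρ V^{⊗N})` vanish, and the error is zero. If `N θ ≤ π / 2`, the average of `ρ₁^{⊗N}` and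
`ρ₂^{⊗N}` satisfies `diag (ρ V^{⊗N}) = cos (N θ) diag ρ` and commutes with `V^{⊗N}`, so every
measurement outcome leaves the same problem of discriminating two vectors of overlap `cos (N θ)`;
projections solve it optimally (`mem_achievable_of_uniform_overlap`). The spectrum of `V^{⊗N}` lies
in the arc `[-N θ, N θ]`, hence `cos (N θ)` bounds its numerical range from below and the error
attained is at most `ν_q(V^{⊗N})²` (`exists_achievable_le_nu_sq`). With the lower bound, this makes
the error minimal and `E^{⊗N}` optimal.
-/

namespace QuantumCertification

/-! ### Vectors, effects and the spectral theorem for unitary matrices -/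

open scoped MatrixOrder Matrix.Norms.L2Operator in
theorem _root_.Matrix.PosSemidef.exists_conjTranspose_mul_self {n : Type*} [Fintype n]
    [DecidableEq n] {A : Matrix n n ℂ} (hA : A.PosSemidef) : ∃ B : Matrix n n ℂ, A = Bᴴ * B :=
  CStarAlgebra.nonneg_iff_eq_star_mul_self.mp hA.nonneg

theorem star_dotProduct_self {n : Type*} [Fintype n] (x : n → ℂ) :
    star x ⬝ᵥ x = ((∑ i, ‖x i‖ ^ 2 : ℝ) : ℂ) := by
  simp [dotProduct, Complex.conj_mul']

theorem star_dotProduct_comm {n : Type*} [Fintype n] (x y : n → ℂ) :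
    star (star x ⬝ᵥ y) = star y ⬝ᵥ x := by
  simp [dotProduct, mul_comm]

theorem norm_star_dotProduct_le {n : Type*} [Fintype n] (x y : n → ℂ) :
    ‖star x ⬝ᵥ y‖ ≤ √(star x ⬝ᵥ x).re * √(star y ⬝ᵥ y).re := by
  have h := norm_inner_le_norm (𝕜 := ℂ) (WithLp.toLp 2 x) (WithLp.toLp 2 y)
  rw [EuclideanSpace.inner_eq_star_dotProduct, EuclideanSpace.norm_eq, EuclideanSpace.norm_eq,
    dotProduct_comm] at h
  rw [star_dotProduct_self, star_dotProduct_self, Complex.ofReal_re, Complex.ofReal_re]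
  exact h

/-- Cauchy–Schwarz inequality for the form of a positive semidefinite matrix. -/
theorem _root_.Matrix.PosSemidef.norm_dotProduct_mulVec_le {n : Type*} [Fintype n]
    {A : Matrix n n ℂ} (hA : A.PosSemidef) (x y : n → ℂ) :
    ‖star x ⬝ᵥ (A *ᵥ y)‖ ≤ √(star x ⬝ᵥ (A *ᵥ x)).re * √(star y ⬝ᵥ (A *ᵥ y)).re := by
  classical
  obtain ⟨B, rfl⟩ := hA.exists_conjTranspose_mul_self
  have h : ∀ u v : n → ℂ, star u ⬝ᵥ ((Bᴴ * B) *ᵥ v) = star (B *ᵥ u) ⬝ᵥ (B *ᵥ v) := by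
    intro u v
    rw [Matrix.star_mulVec, ← Matrix.mulVec_mulVec, Matrix.dotProduct_mulVec]
  simp only [h]
  exact norm_star_dotProduct_le _ _

theorem _root_.Matrix.PosSemidef.re_dotProduct_mulVec_nonneg {n : Type*} [Fintype n]
    {A : Matrix n n ℂ} (hA : A.PosSemidef) (x : n → ℂ) : 0 ≤ (star x ⬝ᵥ (A *ᵥ x)).re :=
  hA.re_dotProduct_nonneg x

/-- A unitary matrix is diagonalized by a unitary change of basis. A scalar `w` of modulus one
outside the spectrum of `V` turns `V` into the Hermitian matrix `i (w + V) (w - V)⁻¹` (Cayley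
transform), of which `V` is a function. -/
theorem exists_unitary_diagonalization {n : Type*} [Fintype n] [DecidableEq n]
    {V : Matrix n n ℂ} (hV : V ∈ Matrix.unitaryGroup n ℂ) :
    ∃ W ∈ Matrix.unitaryGroup n ℂ, ∃ D : n → ℂ, (∀ j, ‖D j‖ = 1) ∧
      V = W * Matrix.diagonal D * Wᴴ := by
  have hV1 : Vᴴ * V = 1 := Matrix.mem_unitaryGroup_iff'.mp hV
  obtain ⟨w, hw, hws⟩ : ∃ w ∈ Metric.sphere (0 : ℂ) 1, w ∉ spectrum ℂ V := by
    have hinf : (Metric.sphere (0 : ℂ) 1).Infinite := by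
      intro hfin
      have h2 : (Real.cos '' Set.Icc 0 Real.pi).Finite := by
        refine (hfin.image Complex.re).subset ?_
        rintro _ ⟨t, -, rfl⟩
        exact ⟨Complex.exp (t * Complex.I), by simp [Complex.norm_exp_ofReal_mul_I],
          Complex.exp_ofReal_mul_I_re t⟩
      rw [Real.bijOn_cos.image_eq] at h2
      exact Set.Icc_infinite (by norm_num) h2
    obtain ⟨w, hw⟩ := (hinf.sdiff (Matrix.finite_spectrum V)).nonempty
    exact ⟨w, hw.1, hw.2⟩
  have hww : star w * w = 1 := by
    rw [RCLike.star_def, Complex.conj_mul']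
    simp only [mem_sphere_iff_norm, sub_zero] at hw
    simp [hw]
  rw [spectrum.notMem_iff] at hws
  obtain ⟨R, hR⟩ : ∃ R, R = algebraMap ℂ (Matrix n n ℂ) w - V := ⟨_, rfl⟩
  rw [← hR] at hws
  have hRR : R = w • 1 - V := by rw [hR, Algebra.algebraMap_eq_smul_one]
  have hdet : IsUnit R.det := (Matrix.isUnit_iff_isUnit_det _).mp hws
  have hSR : R⁻¹ * R = 1 := Matrix.nonsing_inv_mul _ hdet
  set H : Matrix n n ℂ := (Complex.I • (w • 1 + V)) * R⁻¹ with hH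
  have hHR : H * R = Complex.I • (w • 1 + V) := by rw [hH, mul_assoc, hSR, mul_one]
  have hherm : H.IsHermitian := by
    have key : Rᴴ * (H * R) = (H * R)ᴴ * R := by
      rw [hHR, hRR]
      simp only [Matrix.conjTranspose_sub, Matrix.conjTranspose_add, Matrix.conjTranspose_smul,
        Matrix.conjTranspose_one, mul_add, mul_sub, sub_mul, add_mul, smul_mul_assoc,
        mul_smul_comm, one_mul, mul_one, hV1, smul_add, smul_sub, smul_smul]
      have hI : star Complex.I = -Complex.I := Complex.conj_I
      have hIw : star (Complex.I * w) = -Complex.I * star w := by rw [star_mul', hI]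
      match_scalars <;> simp only [hIw, hI] <;>
        first | ring1 | linear_combination 2 * Complex.I * hww
    have h2 : Rᴴ * (H - Hᴴ) * R = 0 := by
      rw [mul_sub, sub_mul, mul_assoc, key, Matrix.conjTranspose_mul, sub_self]
    have hRu : IsUnit Rᴴ := (Matrix.isUnit_conjTranspose R).mpr hws
    have h3 : H - Hᴴ = 0 := by
      have := (hws.mul_left_eq_zero).mp h2
      exact (hRu.mul_right_eq_zero).mp this
    exact (sub_eq_zero.mp h3).symm
  obtain ⟨W, hW, l, hl⟩ : ∃ W ∈ Matrix.unitaryGroup n ℂ, ∃ l : n → ℝ,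
      H = W * Matrix.diagonal (fun i => (l i : ℂ)) * Wᴴ := by
    refine ⟨hherm.eigenvectorUnitary, hherm.eigenvectorUnitary.2, hherm.eigenvalues, ?_⟩
    conv_lhs => rw [hherm.spectral_theorem]
    rw [Unitary.conjStarAlgAut_apply]
    rfl
  have hW1 : Wᴴ * W = 1 := Matrix.mem_unitaryGroup_iff'.mp hW
  have hW2 : W * Wᴴ = 1 := Matrix.mem_unitaryGroup_iff.mp hW
  have hlne : ∀ i, (l i : ℂ) + Complex.I ≠ 0 := by
    intro i h
    have := congrArg Complex.im h
    simp at this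
  have hrel : (H + Complex.I • 1) * V = w • (H - Complex.I • 1) := by
    have h := hHR
    rw [hRR, mul_sub, mul_smul_comm, mul_one, smul_add] at h
    rw [add_mul, smul_mul_assoc, one_mul, smul_sub, sub_eq_iff_eq_add.mp h, smul_comm w]
    abel
  set X := Wᴴ * V * W with hX
  have hXrel : ∀ j k, ((l j : ℂ) + Complex.I) * X j k
      = (Matrix.diagonal (fun j => w * ((l j : ℂ) - Complex.I)) : Matrix n n ℂ) j k := by
    intro j k
    have h1 : Wᴴ * ((H + Complex.I • 1) * V) * W =
        Matrix.diagonal (fun i => (l i : ℂ) + Complex.I) * X := by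
      have : Wᴴ * (H + Complex.I • 1) =
          Matrix.diagonal (fun i => (l i : ℂ) + Complex.I) * Wᴴ := by
        rw [mul_add, hl, ← mul_assoc, ← mul_assoc, hW1, one_mul, mul_smul_comm, mul_one,
          ← Matrix.diagonal_add, add_mul, ← Matrix.smul_one_eq_diagonal, smul_mul_assoc, one_mul]
      rw [← mul_assoc Wᴴ, this, hX]
      simp only [mul_assoc]
    have h2 : Wᴴ * (w • (H - Complex.I • 1)) * W =
        Matrix.diagonal (fun j => w * ((l j : ℂ) - Complex.I)) := by
      have h3 : Wᴴ * H * W = Matrix.diagonal (fun i => (l i : ℂ)) := by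
        rw [hl, mul_assoc, mul_assoc, hW1, mul_one, ← mul_assoc, hW1, one_mul]
      rw [mul_smul_comm, smul_mul_assoc, mul_sub, sub_mul, h3, mul_smul_comm, mul_one,
        smul_mul_assoc, hW1, Matrix.smul_one_eq_diagonal, Matrix.diagonal_sub,
        ← Matrix.diagonal_smul]
      rfl
    rw [← h2, ← hrel, h1, Matrix.diagonal_mul]
  have hXd : X = Matrix.diagonal (fun j => w * ((l j : ℂ) - Complex.I) / (l j + Complex.I)) := by
    ext j k
    have h := hXrel j k
    by_cases hjk : j = k
    · subst hjk
      rw [Matrix.diagonal_apply_eq] at h ⊢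
      rw [eq_div_iff (hlne j), mul_comm, h]
    · rw [Matrix.diagonal_apply_ne _ hjk] at h ⊢
      exact (mul_eq_zero.mp h).resolve_left (hlne j)
  refine ⟨W, hW, fun j => w * ((l j : ℂ) - Complex.I) / (l j + Complex.I), fun j => ?_, ?_⟩
  rotate_left
  · rw [← hXd, hX, mul_assoc, mul_assoc, hW2, mul_one, ← mul_assoc, hW2, one_mul]
  · have h1 : ‖w‖ = 1 := by simpa using hw
    have h2 : ‖(l j : ℂ) - Complex.I‖ = ‖(l j : ℂ) + Complex.I‖ := by
      rw [← Complex.norm_conj]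
      simp
    rw [norm_div, norm_mul, h1, one_mul, h2, div_self (norm_ne_zero_iff.mpr (hlne j))]

/-! ### Error bounds for pure states -/

/-- In terms of angles `q = cos Q`, `c = cos C`, `a = cos A`, `b = cos B`: if `A ≤ Q` and
`A - B` is at most `C` in modulus, then `cos (Q + C) ≤ cos B`. -/
theorem mul_sub_sqrt_mul_sqrt_le {q c a b : ℝ} (hq : 0 ≤ q) (hc : 0 ≤ c) (hqa : q ≤ a)
    (ha : a ≤ 1) (hb0 : 0 ≤ b) (hb : b ≤ 1)
    (h : c ≤ b * a + √(1 - b ^ 2) * √(1 - a ^ 2)) :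
    q * c - √(1 - q ^ 2) * √(1 - c ^ 2) ≤ b := by
  have ha0 : 0 ≤ a := hq.trans hqa
  set a' := √(1 - a ^ 2)
  set b' := √(1 - b ^ 2)
  have ha2 : a' ^ 2 = 1 - a ^ 2 := Real.sq_sqrt (by nlinarith)
  have hb2 : b' ^ 2 = 1 - b ^ 2 := Real.sq_sqrt (by nlinarith)
  have ha'0 : 0 ≤ a' := Real.sqrt_nonneg _
  set t := b * a + b' * a' with ht
  have hs : √(1 - t ^ 2) = |a * b' - a' * b| := by
    rw [← Real.sqrt_sq_eq_abs]
    congr 1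
    have : (1 : ℝ) = (a ^ 2 + a' ^ 2) * (b ^ 2 + b' ^ 2) := by rw [ha2, hb2]; ring
    rw [ht, this]
    ring
  have h1 : a' ≤ √(1 - q ^ 2) := Real.sqrt_le_sqrt (by nlinarith)
  have h2 : √(1 - t ^ 2) ≤ √(1 - c ^ 2) := Real.sqrt_le_sqrt (by nlinarith)
  have h3 : q * c ≤ a * t := mul_le_mul hqa h hc ha0
  have h4 : a' * √(1 - t ^ 2) ≤ √(1 - q ^ 2) * √(1 - c ^ 2) :=
    mul_le_mul h1 h2 (Real.sqrt_nonneg _) (Real.sqrt_nonneg _)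
  have h5 : a' * (a * b' - a' * b) ≤ a' * √(1 - t ^ 2) := by
    rw [hs]
    exact mul_le_mul_of_nonneg_left (le_abs_self _) ha'0
  have h6 : a * t - a' * (a * b' - a' * b) = b := by
    rw [ht]
    linear_combination b * ha2
  linarith

theorem IsEffect.re_le {m : Type*} [Fintype m] [DecidableEq m] {Ω : Matrix m m ℂ}
    (hΩ : IsEffect Ω) {x : m → ℂ} (hx : IsPureState x) :
    (star x ⬝ᵥ ((1 - Ω) *ᵥ x)).re = 1 - (star x ⬝ᵥ (Ω *ᵥ x)).re ∧
      (star x ⬝ᵥ (Ω *ᵥ x)).re ≤ 1 := by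
  have h1 : (star x ⬝ᵥ ((1 - Ω) *ᵥ x)).re = 1 - (star x ⬝ᵥ (Ω *ᵥ x)).re := by
    rw [Matrix.sub_mulVec, Matrix.one_mulVec, dotProduct_sub, hx, Complex.sub_re, Complex.one_re]
  have h2 := hΩ.2.re_dotProduct_mulVec_nonneg x
  exact ⟨h1, by linarith⟩

/-- The overlap of two pure states bounds how well an effect `Ω` distinguishes them: an `Ω` that
accepts `X` with probability at least `q ^ 2` accepts `Y` with probability at least
`(q c - √(1 - q²) √(1 - c²)) ^ 2`. -/
theorem IsEffect.sq_le_re {m : Type*} [Fintype m] [DecidableEq m] {Ω : Matrix m m ℂ}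
    (hΩ : IsEffect Ω) {X Y : m → ℂ} (hX : IsPureState X) (hY : IsPureState Y) {q c : ℝ}
    (hq : 0 ≤ q) (hc : 0 ≤ c) (hqX : q ^ 2 ≤ (star X ⬝ᵥ (Ω *ᵥ X)).re)
    (hcXY : c ≤ ‖star Y ⬝ᵥ X‖) (h0 : 0 ≤ q * c - √(1 - q ^ 2) * √(1 - c ^ 2)) :
    (q * c - √(1 - q ^ 2) * √(1 - c ^ 2)) ^ 2 ≤ (star Y ⬝ᵥ (Ω *ᵥ Y)).re := by
  obtain ⟨hX1, hX2⟩ := hΩ.re_le hX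
  obtain ⟨hY1, hY2⟩ := hΩ.re_le hY
  have hX0 := hΩ.1.re_dotProduct_mulVec_nonneg X
  have hY0 := hΩ.1.re_dotProduct_mulVec_nonneg Y
  have hC1 := hΩ.1.norm_dotProduct_mulVec_le Y X
  have hC2 := hΩ.2.norm_dotProduct_mulVec_le Y X
  have hsum : star Y ⬝ᵥ X = star Y ⬝ᵥ (Ω *ᵥ X) + star Y ⬝ᵥ ((1 - Ω) *ᵥ X) := by
    rw [Matrix.sub_mulVec, Matrix.one_mulVec, dotProduct_sub]
    ring
  rw [hX1, hY1] at hC2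
  set α := (star X ⬝ᵥ (Ω *ᵥ X)).re
  set β := (star Y ⬝ᵥ (Ω *ᵥ Y)).re
  have hle : c ≤ √β * √α + √(1 - √β ^ 2) * √(1 - √α ^ 2) := by
    rw [Real.sq_sqrt hX0, Real.sq_sqrt hY0]
    refine hcXY.trans ?_
    rw [hsum]
    exact (norm_add_le _ _).trans (add_le_add hC1 hC2)
  have hβ := mul_sub_sqrt_mul_sqrt_le hq hc (Real.le_sqrt_of_sq_le hqX)
    (Real.sqrt_le_one.mpr hX2) (Real.sqrt_nonneg β) (Real.sqrt_le_one.mpr hY2) hle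
  calc _ ≤ √β ^ 2 := pow_le_pow_left₀ h0 hβ 2
    _ = β := Real.sq_sqrt hY0

/-! ### The `q`-numerical range of a unitary matrix -/

theorem IsPureState.mulVec {n : Type*} [Fintype n] [DecidableEq n] {V : Matrix n n ℂ}
    (hV : V ∈ Matrix.unitaryGroup n ℂ) {x : n → ℂ} (hx : IsPureState x) :
    IsPureState (V *ᵥ x) := by
  have hV1 : Vᴴ * V = 1 := Matrix.mem_unitaryGroup_iff'.mp hV
  rw [IsPureState, Matrix.star_mulVec, ← Matrix.dotProduct_mulVec, Matrix.mulVec_mulVec, hV1,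
    Matrix.one_mulVec, hx]

theorem conjTranspose_mem_unitaryGroup {n : Type*} [Fintype n] [DecidableEq n]
    {V : Matrix n n ℂ} (hV : V ∈ Matrix.unitaryGroup n ℂ) : Vᴴ ∈ Matrix.unitaryGroup n ℂ :=
  Unitary.star_mem hV

theorem star_dotProduct_mulVec {n m : Type*} [Fintype n] [Fintype m] (V : Matrix n m ℂ)
    (x : n → ℂ) (y : m → ℂ) : star x ⬝ᵥ (V *ᵥ y) = star (Vᴴ *ᵥ x) ⬝ᵥ y := by
  rw [Matrix.star_mulVec, Matrix.conjTranspose_conjTranspose, Matrix.dotProduct_mulVec]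

theorem isPureState_inv_sqrt_smul {n : Type*} [Fintype n] {x : n → ℂ}
    (hx : 0 < (star x ⬝ᵥ x).re) :
    IsPureState (((√(star x ⬝ᵥ x).re : ℝ) : ℂ)⁻¹ • x) := by
  have h : star x ⬝ᵥ x = (((star x ⬝ᵥ x).re : ℝ) : ℂ) := by
    rw [star_dotProduct_self, Complex.ofReal_re]
  set s := (star x ⬝ᵥ x).re
  rw [IsPureState, star_smul, smul_dotProduct, dotProduct_smul, h, star_inv₀,
    Complex.star_def, Complex.conj_ofReal, smul_eq_mul, smul_eq_mul]
  have : (√s : ℂ) ≠ 0 := by exact_mod_cast (Real.sqrt_pos.mpr hx).ne'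
  field_simp
  exact_mod_cast (Real.sq_sqrt hx.le).symm

theorem exists_isPureState_orthogonal {n : Type*} [Fintype n] [Nontrivial n] (x : n → ℂ) :
    ∃ y : n → ℂ, IsPureState y ∧ star x ⬝ᵥ y = 0 := by
  classical
  obtain ⟨a, b, hab⟩ := exists_pair_ne n
  obtain ⟨y, hy, hxy⟩ : ∃ y : n → ℂ, y ≠ 0 ∧ star x ⬝ᵥ y = 0 := by
    by_cases hb : x b = 0
    · exact ⟨Pi.single b 1, by simp, by simp [hb]⟩
    · refine ⟨Pi.single a (star (x b)) - Pi.single b (star (x a)), ?_, ?_⟩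
      · intro h
        have := congrFun h a
        simp [Pi.single_eq_of_ne hab] at this
        exact hb this
      · simp [dotProduct_sub, mul_comm]
  have hpos : 0 < (star y ⬝ᵥ y).re := by
    rw [star_dotProduct_self, Complex.ofReal_re]
    obtain ⟨i, hi⟩ := Function.ne_iff.mp hy
    exact Finset.sum_pos' (fun _ _ => by positivity)
      ⟨i, Finset.mem_univ _, by have := norm_pos_iff.mpr hi; positivity⟩
  exact ⟨_, isPureState_inv_sqrt_smul hpos, by rw [dotProduct_smul, hxy, smul_zero]⟩

theorem nu_nonneg {n : Type*} [Fintype n] (q : ℂ) (X : Matrix n n ℂ) : 0 ≤ nu q X := by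
  refine Real.sInf_nonneg ?_
  rintro _ ⟨z, -, rfl⟩
  exact norm_nonneg z

theorem nu_le_norm {n : Type*} [Fintype n] {q : ℂ} {X : Matrix n n ℂ} {z : ℂ}
    (hz : z ∈ qNumericalRange q X) : nu q X ≤ ‖z‖ := by
  refine csInf_le ⟨0, ?_⟩ ⟨z, hz, rfl⟩
  rintro _ ⟨z, -, rfl⟩
  exact norm_nonneg z

/-- Upper bound for `ν_q(V)` from one vector `ψ`: the minimum of `|⟨ψ|V|φ⟩|` over the admissible
`φ` is reached in the plane spanned by `ψ` and `V† ψ`. -/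
theorem nu_le_of_isPureState {n : Type*} [Fintype n] [DecidableEq n] [Nontrivial n]
    {V : Matrix n n ℂ} (hV : V ∈ Matrix.unitaryGroup n ℂ) {q : ℝ} (hq1 : q ≤ 1) (hq0 : 0 ≤ q)
    {ψ : n → ℂ} (hψ : IsPureState ψ) {c : ℝ} (hc : c = ‖star ψ ⬝ᵥ (V *ᵥ ψ)‖)
    (h0 : 0 ≤ q * c - √(1 - q ^ 2) * √(1 - c ^ 2)) :
    nu (q : ℂ) V ≤ q * c - √(1 - q ^ 2) * √(1 - c ^ 2) := by
  set z := star ψ ⬝ᵥ (V *ᵥ ψ) with hz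
  have hVψ : IsPureState (Vᴴ *ᵥ ψ) := hψ.mulVec (conjTranspose_mem_unitaryGroup hV)
  set χ := Vᴴ *ᵥ ψ
  have hzχ : star χ ⬝ᵥ ψ = z := by rw [hz, star_dotProduct_mulVec]
  have hzχ' : star ψ ⬝ᵥ χ = star z := by rw [← hzχ, star_dotProduct_comm]
  have hzz : z * star z = ((c ^ 2 : ℝ) : ℂ) := by
    rw [hc, Complex.star_def, Complex.mul_conj']
    push_cast
    rfl
  have hr : star (χ - star z • ψ) ⬝ᵥ (χ - star z • ψ) = ((1 - c ^ 2 : ℝ) : ℂ) := by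
    simp only [star_sub, star_smul, star_star, sub_dotProduct, dotProduct_sub, smul_dotProduct,
      dotProduct_smul, hzχ, hzχ', smul_eq_mul]
    rw [hVψ, hψ]
    push_cast at hzz ⊢
    linear_combination -hzz
  have hc2 : 0 ≤ 1 - c ^ 2 := by
    have := congrArg Complex.re hr
    rw [star_dotProduct_self, Complex.ofReal_re, Complex.ofReal_re] at this
    rw [← this]
    positivity
  obtain ⟨η, hη, hηψ, hηχ⟩ : ∃ η, IsPureState η ∧ star ψ ⬝ᵥ η = 0 ∧
      star χ ⬝ᵥ η = ((√(1 - c ^ 2) : ℝ) : ℂ) := by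
    rcases hc2.eq_or_lt with h | h
    · obtain ⟨η, hη, hηψ⟩ := exists_isPureState_orthogonal ψ
      refine ⟨η, hη, hηψ, ?_⟩
      have hzero : χ - star z • ψ = 0 := by
        rw [← h, Complex.ofReal_zero] at hr
        exact dotProduct_star_self_eq_zero.mp hr
      rw [sub_eq_zero.mp hzero, star_smul, smul_dotProduct, hηψ, ← h]
      simp
    · have hpos : 0 < (star (χ - star z • ψ) ⬝ᵥ (χ - star z • ψ)).re := by
        rw [hr, Complex.ofReal_re]; exact h
      have hpure := isPureState_inv_sqrt_smul hpos
      rw [hr, Complex.ofReal_re] at hpure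
      refine ⟨_, hpure, ?_, ?_⟩
      · rw [dotProduct_smul, dotProduct_sub, dotProduct_smul, hzχ', hψ]
        simp
      · rw [dotProduct_smul, dotProduct_sub, dotProduct_smul, hzχ, hVψ, smul_eq_mul, smul_eq_mul,
          mul_comm (star z), hzz]
        have : ((√(1 - c ^ 2) : ℝ) : ℂ) ≠ 0 := by exact_mod_cast (Real.sqrt_pos.mpr h).ne'
        rw [inv_mul_eq_iff_eq_mul₀ this]
        norm_cast
        rw [Real.mul_self_sqrt hc2]
  obtain ⟨ω, hω, hzω⟩ : ∃ ω : ℂ, ‖ω‖ = 1 ∧ z = ω * c := by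
    by_cases hz0 : z = 0
    · exact ⟨1, norm_one, by rw [hc, hz0]; simp⟩
    · have : (‖z‖ : ℂ) ≠ 0 := by exact_mod_cast norm_ne_zero_iff.mpr hz0
      refine ⟨z / ‖z‖, ?_, ?_⟩
      · rw [norm_div, Complex.norm_real, norm_norm, div_self (norm_ne_zero_iff.mpr hz0)]
      · rw [hc, div_mul_cancel₀ _ this]
  have hωω : star ω * ω = 1 := by rw [Complex.star_def, Complex.conj_mul', hω]; simp
  have hηψ' : star η ⬝ᵥ ψ = 0 := by rw [← star_dotProduct_comm, hηψ, star_zero]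
  have hs : ((√(1 - q ^ 2) : ℝ) : ℂ) * ((√(1 - q ^ 2) : ℝ) : ℂ) = 1 - (q : ℂ) ^ 2 := by
    norm_cast
    rw [Real.mul_self_sqrt (by nlinarith)]
  have hmem : ω * ((q * c - √(1 - q ^ 2) * √(1 - c ^ 2) : ℝ) : ℂ) ∈
      qNumericalRange (q : ℂ) V := by
    refine ⟨ψ, (q : ℂ) • ψ - (((√(1 - q ^ 2) : ℝ) : ℂ) * ω) • η, hψ, ?_, ?_, ?_⟩
    · rw [IsPureState]
      simp only [star_sub, star_smul, sub_dotProduct, dotProduct_sub, smul_dotProduct,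
        dotProduct_smul, hηψ, hηψ', smul_eq_mul, star_mul', Complex.star_def,
        Complex.conj_ofReal]
      rw [hψ, hη]
      rw [Complex.star_def] at hωω
      linear_combination hs + ((√(1 - q ^ 2) : ℝ) : ℂ) * ((√(1 - q ^ 2) : ℝ) : ℂ) * hωω
    · rw [dotProduct_sub, dotProduct_smul, dotProduct_smul, hηψ, hψ]
      simp
    · rw [star_dotProduct_mulVec, dotProduct_sub, dotProduct_smul, dotProduct_smul, hηχ, hzχ, hzω,
        smul_eq_mul, smul_eq_mul]
      push_cast
      ring
  have := nu_le_norm hmem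
  rwa [norm_mul, hω, one_mul, Complex.norm_real, Real.norm_of_nonneg h0] at this

/-- Lower bound for `ν_q(V)` from a lower bound for the moduli in the numerical range of `V`. -/
theorem le_nu_of_le_norm {n : Type*} [Fintype n] [DecidableEq n] [Nontrivial n]
    {V : Matrix n n ℂ} (hV : V ∈ Matrix.unitaryGroup n ℂ) {q : ℝ} (hq1 : q ≤ 1) (hq0 : 0 ≤ q)
    {c : ℝ} (hc0 : 0 ≤ c) (hc : ∀ ψ, IsPureState ψ → c ≤ ‖star ψ ⬝ᵥ (V *ᵥ ψ)‖)
    (h0 : 0 ≤ q * c - √(1 - q ^ 2) * √(1 - c ^ 2)) :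
    q * c - √(1 - q ^ 2) * √(1 - c ^ 2) ≤ nu (q : ℂ) V := by
  obtain ⟨_, ⟨ψ, φ, hψ, hφ, hψφ, rfl⟩, hnu⟩ :=
    (isLeast_nu (q := (q : ℂ)) (by rw [Complex.norm_real, Real.norm_of_nonneg hq0]; exact hq1) V).1
  rw [← hnu]
  have hval : ∀ x : n → ℂ, star x ⬝ᵥ (proj φ *ᵥ x) = ((‖star x ⬝ᵥ φ‖ ^ 2 : ℝ) : ℂ) := by
    intro x
    rw [proj, Matrix.vecMulVec_mulVec, ← star_dotProduct_comm x φ, op_smul_eq_smul,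
      dotProduct_smul, smul_eq_mul, Complex.star_def, Complex.conj_mul']
    push_cast
    rfl
  have hproj : IsEffect (proj φ) := by
    refine ⟨Matrix.posSemidef_vecMulVec_self_star φ, ?_⟩
    refine Matrix.PosSemidef.of_dotProduct_mulVec_nonneg
      (Matrix.isHermitian_one.sub (Matrix.posSemidef_vecMulVec_self_star φ).1) fun x => ?_
    rw [Matrix.sub_mulVec, Matrix.one_mulVec, dotProduct_sub, hval, star_dotProduct_self,
      ← Complex.ofReal_sub, Complex.zero_le_real, sub_nonneg]
    have h := norm_star_dotProduct_le x φ
    rw [hφ, Complex.one_re, Real.sqrt_one, mul_one, star_dotProduct_self, Complex.ofReal_re] at h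
    calc ‖star x ⬝ᵥ φ‖ ^ 2 ≤ √(∑ i, ‖x i‖ ^ 2) ^ 2 := pow_le_pow_left₀ (norm_nonneg _) h 2
      _ = _ := Real.sq_sqrt (by positivity)
  have h := hproj.sq_le_re hψ (hψ.mulVec (conjTranspose_mem_unitaryGroup hV)) hq0 hc0 (q := q)
    (by rw [hval, hψφ, Complex.ofReal_re, Complex.norm_real, Real.norm_of_nonneg hq0])
    (by rw [← star_dotProduct_mulVec]; exact hc ψ hψ) h0
  rw [hval, Complex.ofReal_re, ← star_dotProduct_mulVec] at h
  exact (pow_le_pow_iff_left₀ h0 (norm_nonneg _) two_ne_zero).mp h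

/-! ### The `q`-numerical range bounds the distinguishability with an auxiliary system -/

theorem star_dotProduct_diagonalized_mulVec {n : Type*} [Fintype n] [DecidableEq n]
    (W : Matrix n n ℂ) (D : n → ℂ) (x : n → ℂ) :
    star x ⬝ᵥ ((W * Matrix.diagonal D * Wᴴ) *ᵥ x) = ∑ j, ((‖(Wᴴ *ᵥ x) j‖ ^ 2 : ℝ) : ℂ) * D j := by
  rw [← Matrix.mulVec_mulVec, ← Matrix.mulVec_mulVec, star_dotProduct_mulVec, dotProduct]
  refine Finset.sum_congr rfl fun j _ => ?_
  rw [Matrix.mulVec_diagonal, Pi.star_apply, Complex.ofReal_pow, ← Complex.conj_mul',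
    Complex.star_def]
  ring

/-- Every convex combination of the eigenvalues of a unitary matrix lies in its numerical
range. -/
theorem exists_isPureState_of_weights {n : Type*} [Fintype n] [DecidableEq n]
    {W : Matrix n n ℂ} (hW : W ∈ Matrix.unitaryGroup n ℂ) (D : n → ℂ) {p : n → ℝ}
    (hp : ∀ j, 0 ≤ p j) (hp1 : ∑ j, p j = 1) :
    ∃ ψ, IsPureState ψ ∧
      star ψ ⬝ᵥ ((W * Matrix.diagonal D * Wᴴ) *ᵥ ψ) = ∑ j, (p j : ℂ) * D j := by
  have hW1 : Wᴴ * W = 1 := Matrix.mem_unitaryGroup_iff'.mp hW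
  have hnorm : ∀ j, ‖((√(p j) : ℝ) : ℂ)‖ ^ 2 = p j := fun j => by
    rw [Complex.norm_real, Real.norm_of_nonneg (Real.sqrt_nonneg _), Real.sq_sqrt (hp j)]
  have hpure : IsPureState fun j => ((√(p j) : ℝ) : ℂ) := by
    rw [isPureState_iff]
    simp only [hnorm, hp1]
  refine ⟨W *ᵥ fun j => ((√(p j) : ℝ) : ℂ), hpure.mulVec hW, ?_⟩
  rw [star_dotProduct_diagonalized_mulVec, Matrix.mulVec_mulVec, hW1, Matrix.one_mulVec]
  simp only [hnorm]

/-- The vector `(A ⊗ 1) ψ`. -/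
def applyLocal {n κ : Type*} [Fintype n] (A : Matrix n n ℂ) (ψ : n × κ → ℂ) : n × κ → ℂ :=
  fun p => (A *ᵥ fun j => ψ (j, p.2)) p.1

theorem star_dotProduct_prod {n κ : Type*} [Fintype n] [Fintype κ] (x y : n × κ → ℂ) :
    star x ⬝ᵥ y = ∑ a, star (fun j => x (j, a)) ⬝ᵥ fun j => y (j, a) := by
  simp only [dotProduct, Fintype.sum_prod_type_right, Pi.star_apply]

theorem IsPureState.applyLocal {n κ : Type*} [Fintype n] [DecidableEq n] [Fintype κ]
    {A : Matrix n n ℂ} (hA : A ∈ Matrix.unitaryGroup n ℂ) {ψ : n × κ → ℂ} (hψ : IsPureState ψ) :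
    IsPureState (applyLocal A ψ) := by
  have hA1 : Aᴴ * A = 1 := Matrix.mem_unitaryGroup_iff'.mp hA
  rw [IsPureState, star_dotProduct_prod] at hψ ⊢
  rw [← hψ]
  refine Finset.sum_congr rfl fun a _ => ?_
  change star (A *ᵥ fun j => ψ (j, a)) ⬝ᵥ (A *ᵥ fun j => ψ (j, a)) = _
  rw [star_dotProduct_mulVec, Matrix.mulVec_mulVec, hA1, Matrix.one_mulVec]

/-- An effect on the joint system accepting `ψ` with probability at least `q ^ 2` accepts
`(V† ⊗ 1) ψ` with probability at least `ν_q(V) ^ 2`. The overlap of the two states is a convex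
combination of eigenvalues of `V`, hence in the numerical range of `V`. If its modulus is below
`√(1 - q²)`, moving the weights towards one eigenvalue yields a vector for which it equals
`√(1 - q²)`, so that `ν_q(V) = 0`. -/
theorem nu_sq_le_re {n κ : Type*} [Fintype n] [DecidableEq n] [Nontrivial n] [Fintype κ]
    [DecidableEq κ] {V : Matrix n n ℂ} (hV : V ∈ Matrix.unitaryGroup n ℂ) {q : ℝ} (hq0 : 0 ≤ q)
    (hq1 : q ≤ 1) {ψ : n × κ → ℂ} (hψ : IsPureState ψ) {Ω : Matrix (n × κ) (n × κ) ℂ}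
    (hΩ : IsEffect Ω) (hq : q ^ 2 ≤ (star ψ ⬝ᵥ (Ω *ᵥ ψ)).re) :
    nu (q : ℂ) V ^ 2 ≤ (star (applyLocal Vᴴ ψ) ⬝ᵥ (Ω *ᵥ applyLocal Vᴴ ψ)).re := by
  obtain ⟨W, hW, D, hD, hVW⟩ := exists_unitary_diagonalization hV
  set z := star (applyLocal Vᴴ ψ) ⬝ᵥ ψ with hz
  set p : n → ℝ := fun j => ∑ a, ‖(Wᴴ *ᵥ fun i => ψ (i, a)) j‖ ^ 2 with hp
  have hp0 : ∀ j, 0 ≤ p j := fun j => by positivity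
  have hp1 : ∑ j, p j = 1 := by
    have h := hψ.applyLocal (conjTranspose_mem_unitaryGroup hW)
    rw [isPureState_iff, Fintype.sum_prod_type] at h
    exact h
  have hzp : z = ∑ j, (p j : ℂ) * D j := by
    rw [hz, star_dotProduct_prod]
    simp only [hp, Complex.ofReal_sum, Finset.sum_mul]
    rw [Finset.sum_comm]
    refine Finset.sum_congr rfl fun a _ => ?_
    change star (Vᴴ *ᵥ fun j => ψ (j, a)) ⬝ᵥ _ = _
    rw [← star_dotProduct_mulVec, hVW, star_dotProduct_diagonalized_mulVec]
  have hs1 : √(1 - q ^ 2) ≤ 1 := Real.sqrt_le_one.mpr (by nlinarith)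
  have hs0 : 0 ≤ √(1 - q ^ 2) := Real.sqrt_nonneg _
  have hYpure := hψ.applyLocal (conjTranspose_mem_unitaryGroup hV)
  rcases le_total (√(1 - q ^ 2)) ‖z‖ with h | h
  · obtain ⟨φ, hφ, hφz⟩ := exists_isPureState_of_weights hW D hp0 hp1
    have hg : 0 ≤ q * ‖z‖ - √(1 - q ^ 2) * √(1 - ‖z‖ ^ 2) := by
      have h1 : √(1 - ‖z‖ ^ 2) ≤ q := by
        refine Real.sqrt_le_iff.mpr ⟨hq0, ?_⟩
        have := pow_le_pow_left₀ hs0 h 2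
        rw [Real.sq_sqrt (by nlinarith)] at this
        linarith
      nlinarith [mul_le_mul h h1 (Real.sqrt_nonneg _) (norm_nonneg z)]
    have hnu := nu_le_of_isPureState hV hq1 hq0 hφ (c := ‖z‖) (by rw [hVW, hφz, hzp]) hg
    exact (pow_le_pow_left₀ (nu_nonneg _ _) hnu 2).trans
      (hΩ.sq_le_re hψ hYpure hq0 (norm_nonneg z) hq le_rfl hg)
  · obtain ⟨j₀⟩ : Nonempty n := inferInstance
    have hcont : Continuous fun t : ℝ =>
        ‖∑ j, (((1 - t) * p j + t * (Pi.single j₀ 1 : n → ℝ) j : ℝ) : ℂ) * D j‖ := by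
      fun_prop
    obtain ⟨t, ht, htz⟩ := intermediate_value_Icc (zero_le_one' ℝ) hcont.continuousOn
      (show √(1 - q ^ 2) ∈ Set.Icc _ _ by
        constructor
        · simpa [← hzp] using h
        · have h1 : ∑ j, (((1 - 1) * p j + 1 * (Pi.single j₀ 1 : n → ℝ) j : ℝ) : ℂ) * D j =
              D j₀ := by
            rw [Finset.sum_eq_single j₀ (fun j _ hj => by simp [Pi.single_eq_of_ne hj]) (by simp)]
            simp
          rwa [h1, hD])
    have hsingle0 : (0 : n → ℝ) ≤ Pi.single j₀ 1 := Pi.single_nonneg.mpr zero_le_one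
    have hsingle : ∑ j, (Pi.single j₀ 1 : n → ℝ) j = 1 := by simp
    obtain ⟨φ, hφ, hφz⟩ := exists_isPureState_of_weights hW D
      (p := fun j => (1 - t) * p j + t * (Pi.single j₀ 1 : n → ℝ) j)
      (fun j => add_nonneg (mul_nonneg (sub_nonneg.mpr ht.2) (hp0 j))
        (mul_nonneg ht.1 (hsingle0 j)))
      (by rw [Finset.sum_add_distrib, ← Finset.mul_sum, ← Finset.mul_sum, hp1, hsingle]; ring)
    have hg : q * √(1 - q ^ 2) - √(1 - q ^ 2) * √(1 - √(1 - q ^ 2) ^ 2) = 0 := by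
      rw [Real.sq_sqrt (by nlinarith), sub_sub_cancel, Real.sqrt_sq hq0]
      ring
    have hnu := nu_le_of_isPureState hV hq1 hq0 hφ (c := √(1 - q ^ 2))
      (by rw [hVW, hφz]; exact htz.symm) hg.ge
    rw [hg] at hnu
    rw [le_antisymm hnu (nu_nonneg _ _), zero_pow two_ne_zero]
    exact hΩ.1.re_dotProduct_mulVec_nonneg _

/-! ### Errors of a strategy -/

/-- The block-diagonal part of `Ω` with respect to the first factor. -/
def pinch {n κ : Type*} [DecidableEq n] (Ω : Matrix (n × κ) (n × κ) ℂ) :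
    Matrix (n × κ) (n × κ) ℂ :=
  Matrix.of fun p q => if p.1 = q.1 then Ω p q else 0

theorem _root_.Matrix.PosSemidef.pinch {n κ : Type*} [Fintype n] [DecidableEq n] [Fintype κ]
    {Ω : Matrix (n × κ) (n × κ) ℂ} (hΩ : Ω.PosSemidef) : (pinch Ω).PosSemidef := by
  refine Matrix.PosSemidef.of_dotProduct_mulVec_nonneg ?_ fun x => ?_
  · ext p q
    rw [Matrix.conjTranspose_apply, QuantumCertification.pinch, Matrix.of_apply, Matrix.of_apply]
    simp only [eq_comm (a := q.1)]
    split_ifs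
    · exact hΩ.1.apply p q
    · simp
  · have h : star x ⬝ᵥ (QuantumCertification.pinch Ω *ᵥ x) =
        ∑ i, star (fun p : n × κ => if p.1 = i then x p else 0) ⬝ᵥ
          (Ω *ᵥ fun p => if p.1 = i then x p else 0) := by
      simp only [dotProduct, Matrix.mulVec, QuantumCertification.pinch, Matrix.of_apply,
        Pi.star_apply]
      rw [Finset.sum_comm]
      refine Finset.sum_congr rfl fun p _ => ?_
      rw [Finset.sum_eq_single p.1 (fun i _ hi => by rw [if_neg hi.symm]; simp) (by simp)]
      rw [if_pos rfl]
      congr 1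
      refine Finset.sum_congr rfl fun q _ => ?_
      by_cases hpq : p.1 = q.1
      · simp [hpq]
      · simp [hpq, Ne.symm hpq]
    rw [h]
    exact Finset.sum_nonneg fun i _ => hΩ.dotProduct_mulVec_nonneg _

theorem IsEffect.pinch {n κ : Type*} [Fintype n] [DecidableEq n] [Fintype κ] [DecidableEq κ]
    {Ω : Matrix (n × κ) (n × κ) ℂ} (hΩ : IsEffect Ω) : IsEffect (pinch Ω) := by
  refine ⟨hΩ.1.pinch, ?_⟩
  have h : 1 - QuantumCertification.pinch Ω = QuantumCertification.pinch (1 - Ω) := by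
    ext p q
    simp only [QuantumCertification.pinch, Matrix.sub_apply, Matrix.of_apply]
    split_ifs with h
    · rfl
    · rw [Matrix.one_apply_ne (fun hpq => h (by rw [hpq])), sub_zero]
  rw [h]
  exact hΩ.2.pinch

theorem tensorId_vonNeumann_proj {n κ : Type*} [Fintype n] [DecidableEq n] (V : Matrix n n ℂ)
    (ψ : n × κ → ℂ) (p q : n × κ) :
    tensorId κ (vonNeumann V) (proj ψ) p q =
      if p.1 = q.1 then applyLocal Vᴴ ψ p * star (applyLocal Vᴴ ψ q) else 0 := by
  rw [tensorId, Matrix.of_apply, vonNeumann, Matrix.diagonal_apply]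
  split_ifs with h
  · have h1 : (Matrix.of fun i j => proj ψ (i, p.2) (j, q.2)) =
        Matrix.vecMulVec (fun i => ψ (i, p.2)) (star fun j => ψ (j, q.2)) := rfl
    have h2 : ∀ x : n → ℂ, star (V.col p.1) ⬝ᵥ x = (Vᴴ *ᵥ x) p.1 := fun x => rfl
    rw [h1, Matrix.vecMulVec_mulVec, op_smul_eq_smul, dotProduct_smul, h2, smul_eq_mul, mul_comm,
      ← star_dotProduct_comm (V.col p.1), h2]
    simp only [applyLocal, h]
  · rfl

/-- Only the diagonal blocks of `Ω` matter for the output of a measurement, and they are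
insensitive to the phases of its columns. -/
theorem trace_mul_tensorId {n κ : Type*} [Fintype n] [DecidableEq n] [Fintype κ]
    (V : Matrix n n ℂ) {e : n → ℂ} (he : ∀ i, ‖e i‖ = 1) (ψ : n × κ → ℂ)
    (Ω : Matrix (n × κ) (n × κ) ℂ) :
    Matrix.trace (Ω * tensorId κ (vonNeumann V) (proj ψ)) =
      star (applyLocal (V * Matrix.diagonal e)ᴴ ψ) ⬝ᵥ
        (pinch Ω *ᵥ applyLocal (V * Matrix.diagonal e)ᴴ ψ) := by
  have hloc : ∀ p : n × κ, applyLocal (V * Matrix.diagonal e)ᴴ ψ p =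
      star (e p.1) * applyLocal Vᴴ ψ p := by
    intro p
    rw [applyLocal, Matrix.conjTranspose_mul, Matrix.diagonal_conjTranspose,
      ← Matrix.mulVec_mulVec, Matrix.mulVec_diagonal]
    rfl
  simp only [Matrix.trace, Matrix.diag, Matrix.mul_apply, dotProduct, Matrix.mulVec,
    tensorId_vonNeumann_proj, pinch, Matrix.of_apply, Pi.star_apply, hloc, Finset.mul_sum]
  refine Finset.sum_congr rfl fun p _ => Finset.sum_congr rfl fun q _ => ?_
  by_cases h : p.1 = q.1
  · have hee : e q.1 * star (e q.1) = 1 := by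
      rw [Complex.star_def, Complex.mul_conj', he]; simp
    rw [if_pos h, if_pos h.symm, h, star_mul', star_star]
    linear_combination (-(Ω p q) * applyLocal Vᴴ ψ q * star (applyLocal Vᴴ ψ p)) * hee
  · rw [if_neg h, if_neg (Ne.symm h)]
    simp

theorem typeIIError_eq {n κ : Type*} [Fintype n] [DecidableEq n] [Fintype κ]
    (V : Matrix n n ℂ) {e : n → ℂ} (he : ∀ i, ‖e i‖ = 1) (ψ : n × κ → ℂ)
    (Ω : Matrix (n × κ) (n × κ) ℂ) :
    typeIIError (vonNeumann V) ψ Ω =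
      (star (applyLocal (V * Matrix.diagonal e)ᴴ ψ) ⬝ᵥ
        (pinch Ω *ᵥ applyLocal (V * Matrix.diagonal e)ᴴ ψ)).re := by
  rw [typeIIError, trace_mul_tensorId V he]

theorem applyLocal_one {n κ : Type*} [Fintype n] [DecidableEq n] (ψ : n × κ → ℂ) :
    applyLocal 1 ψ = ψ := by
  ext p
  rw [applyLocal, Matrix.one_mulVec]

theorem typeIError_eq {n κ : Type*} [Fintype n] [DecidableEq n] [Fintype κ] [DecidableEq κ]
    {ψ : n × κ → ℂ} (hψ : IsPureState ψ) (Ω : Matrix (n × κ) (n × κ) ℂ) :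
    typeIError (vonNeumann (1 : Matrix n n ℂ)) ψ Ω = 1 - (star ψ ⬝ᵥ (pinch Ω *ᵥ ψ)).re := by
  have h := fun Ω : Matrix (n × κ) (n × κ) ℂ =>
    trace_mul_tensorId (1 : Matrix n n ℂ) (e := 1) (by simp) ψ Ω
  have hone : (1 * Matrix.diagonal (1 : n → ℂ))ᴴ = 1 := by simp
  simp only [hone, applyLocal_one] at h
  have hpone : pinch (1 : Matrix (n × κ) (n × κ) ℂ) = 1 := by
    ext p q
    simp only [pinch, Matrix.of_apply]
    split_ifs with hpq
    · rfl
    · rw [Matrix.one_apply_ne (fun hpq' => hpq (by rw [hpq']))]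
  rw [typeIError, sub_mul, Matrix.trace_sub, h, h, hpone, Matrix.one_mulVec, hψ, Complex.sub_re,
    Complex.one_re]

theorem mul_diagonal_mem_unitaryGroup {n : Type*} [Fintype n] [DecidableEq n]
    {U : Matrix n n ℂ} (hU : U ∈ Matrix.unitaryGroup n ℂ) {e : n → ℂ} (he : ∀ i, ‖e i‖ = 1) :
    U * Matrix.diagonal e ∈ Matrix.unitaryGroup n ℂ := by
  refine mul_mem hU ?_
  rw [Matrix.mem_unitaryGroup_iff, Matrix.star_eq_conjTranspose, Matrix.diagonal_conjTranspose,
    Matrix.diagonal_mul_diagonal, ← Matrix.diagonal_one]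
  congr 1
  ext i
  rw [Pi.star_apply, Complex.star_def, Complex.mul_conj', he]
  simp

/-- Optimality bound: no strategy beats `ν²_{√(1-δ)}(U E)`, for any diagonal unitary `E`. -/
theorem nu_sq_le_of_mem_achievable {n : Type*} [Fintype n] [DecidableEq n] [Nontrivial n]
    {U : Matrix n n ℂ} (hU : U ∈ Matrix.unitaryGroup n ℂ) {δ : ℝ} (hδ0 : 0 ≤ δ) (hδ1 : δ ≤ 1)
    {p : ℝ} (hp : p ∈ achievableTypeIIErrors (vonNeumann 1) (vonNeumann U) δ) {e : n → ℂ}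
    (he : ∀ i, ‖e i‖ = 1) :
    nu ((√(1 - δ) : ℝ) : ℂ) (U * Matrix.diagonal e) ^ 2 ≤ p := by
  obtain ⟨k, ψ, Ω, hψ, hΩ, hI, rfl⟩ := hp
  rw [typeIError_eq hψ] at hI
  rw [typeIIError_eq U he]
  refine nu_sq_le_re (mul_diagonal_mem_unitaryGroup hU he) (Real.sqrt_nonneg _)
    (Real.sqrt_le_one.mpr (by linarith)) hψ hΩ.pinch ?_
  rw [Real.sq_sqrt (by linarith)]
  linarith

/-! ### Strategies that test each measurement outcome by a projection -/

/-- The inner product `⟨x_i|y_i⟩` of the `i`-th blocks of two vectors of the joint system. -/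
def blockInner {n κ : Type*} [Fintype κ] (x y : n × κ → ℂ) (i : n) : ℂ :=
  star (fun a => x (i, a)) ⬝ᵥ fun a => y (i, a)

/-- The block-diagonal matrix whose `i`-th block is the projection onto the line spanned by the
`i`-th block of `φ`. Blocks where `φ` vanishes are zero, because `0⁻¹ = 0`. -/
noncomputable def blockProj {n κ : Type*} [DecidableEq n] [Fintype κ] (φ : n × κ → ℂ) :
    Matrix (n × κ) (n × κ) ℂ :=
  Matrix.of fun p q => if p.1 = q.1 then φ p * star (φ q) * (blockInner φ φ p.1)⁻¹ else 0

theorem blockInner_self {n κ : Type*} [Fintype κ] (x : n × κ → ℂ) (i : n) :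
    blockInner x x i = ((∑ a, ‖x (i, a)‖ ^ 2 : ℝ) : ℂ) :=
  star_dotProduct_self _

theorem sum_blockInner {n κ : Type*} [Fintype n] [Fintype κ] (x y : n × κ → ℂ) :
    ∑ i, blockInner x y i = star x ⬝ᵥ y := by
  simp only [blockInner, dotProduct, Fintype.sum_prod_type, Pi.star_apply]

theorem star_dotProduct_blockProj_mulVec {n κ : Type*} [Fintype n] [DecidableEq n] [Fintype κ]
    (φ y : n × κ → ℂ) :
    star y ⬝ᵥ (blockProj φ *ᵥ y) =
      ((∑ i, ‖blockInner φ y i‖ ^ 2 / (blockInner φ φ i).re : ℝ) : ℂ) := by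
  have hre : ∀ i, (((blockInner φ φ i).re : ℝ) : ℂ) = blockInner φ φ i := fun i => by
    rw [blockInner_self, Complex.ofReal_re]
  have hmul : ∀ i a, (blockProj φ *ᵥ y) (i, a) =
      φ (i, a) * blockInner φ y i * (blockInner φ φ i)⁻¹ := by
    intro i a
    rw [Matrix.mulVec, dotProduct, Fintype.sum_prod_type,
      Finset.sum_eq_single i (fun j _ hj => by simp [blockProj, hj.symm]) (by simp)]
    simp only [blockProj, Matrix.of_apply, if_pos, blockInner, dotProduct, Pi.star_apply,
      Finset.mul_sum, Finset.sum_mul]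
    refine Finset.sum_congr rfl fun b _ => ?_
    ring
  push_cast
  rw [dotProduct, Fintype.sum_prod_type]
  refine Finset.sum_congr rfl fun i _ => ?_
  rw [hre, ← Complex.conj_mul', ← Complex.star_def]
  simp only [hmul, Pi.star_apply]
  have : star (blockInner φ y i) = blockInner y φ i := star_dotProduct_comm _ _
  rw [this, div_eq_mul_inv]
  simp only [blockInner, dotProduct, Pi.star_apply, Finset.sum_mul]
  refine Finset.sum_congr rfl fun a _ => ?_
  ring

theorem isEffect_blockProj {n κ : Type*} [Fintype n] [DecidableEq n] [Fintype κ] [DecidableEq κ]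
    (φ : n × κ → ℂ) : IsEffect (blockProj φ) := by
  have hreal : ∀ i, star (blockInner φ φ i) = blockInner φ φ i := fun i =>
    star_dotProduct_comm _ _
  have hnn : ∀ i, 0 ≤ (blockInner φ φ i).re := fun i => by
    rw [blockInner_self, Complex.ofReal_re]
    positivity
  have hherm : (blockProj φ).IsHermitian := by
    ext p q
    rw [Matrix.conjTranspose_apply, blockProj, Matrix.of_apply, Matrix.of_apply]
    by_cases h : p.1 = q.1
    · rw [if_pos h, if_pos h.symm, star_mul', star_mul', star_star, star_inv₀, hreal, h]
      ring
    · rw [if_neg h, if_neg (Ne.symm h), star_zero]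
  refine ⟨.of_dotProduct_mulVec_nonneg hherm fun y => ?_,
    .of_dotProduct_mulVec_nonneg (Matrix.isHermitian_one.sub hherm) fun y => ?_⟩
  · rw [star_dotProduct_blockProj_mulVec, Complex.zero_le_real]
    exact Finset.sum_nonneg fun i _ => div_nonneg (sq_nonneg _) (hnn i)
  · rw [Matrix.sub_mulVec, Matrix.one_mulVec, dotProduct_sub, star_dotProduct_blockProj_mulVec,
      ← sum_blockInner y y]
    simp only [blockInner_self y]
    rw [← Complex.ofReal_sum, ← Complex.ofReal_sub, Complex.zero_le_real, sub_nonneg]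
    refine Finset.sum_le_sum fun i _ => ?_
    have hcs := norm_star_dotProduct_le (fun a => φ (i, a)) (fun a => y (i, a))
    have hsq : ‖blockInner φ y i‖ ^ 2 ≤ (blockInner φ φ i).re * ∑ a, ‖y (i, a)‖ ^ 2 := by
      refine (pow_le_pow_left₀ (norm_nonneg _) hcs 2).trans_eq ?_
      rw [mul_pow, Real.sq_sqrt
        (show 0 ≤ (star (fun a => φ (i, a)) ⬝ᵥ fun a => φ (i, a)).re from hnn i),
        star_dotProduct_self (fun a => y (i, a)),
        Complex.ofReal_re, Real.sq_sqrt (by positivity)]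
      rfl
    refine div_le_of_le_mul₀ (hnn i) (by positivity) ?_
    rwa [mul_comm]

theorem pinch_blockProj {n κ : Type*} [DecidableEq n] [Fintype κ] (φ : n × κ → ℂ) :
    pinch (blockProj φ) = blockProj φ := by
  ext p q
  simp only [pinch, blockProj, Matrix.of_apply]
  split_ifs <;> rfl

theorem mem_achievable_of_blockProj {n : Type*} [Fintype n] [DecidableEq n] (U : Matrix n n ℂ)
    {δ : ℝ} {e : n → ℂ} (he : ∀ i, ‖e i‖ = 1) {k : ℕ} {ψ : n × Fin k → ℂ} (hψ : IsPureState ψ)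
    (φ : n × Fin k → ℂ)
    (hφ : 1 - δ ≤ ∑ i, ‖blockInner φ ψ i‖ ^ 2 / (blockInner φ φ i).re) :
    ∑ i, ‖blockInner φ (applyLocal (U * Matrix.diagonal e)ᴴ ψ) i‖ ^ 2 / (blockInner φ φ i).re ∈
      achievableTypeIIErrors (vonNeumann 1) (vonNeumann U) δ := by
  refine ⟨k, ψ, blockProj φ, hψ, isEffect_blockProj φ, ?_, ?_⟩
  · rw [typeIError_eq hψ, pinch_blockProj, star_dotProduct_blockProj_mulVec, Complex.ofReal_re]
    linarith
  · rw [typeIIError_eq U he, pinch_blockProj, star_dotProduct_blockProj_mulVec,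
      Complex.ofReal_re]

/-- Every density matrix `ρ` is the marginal of a pure state. -/
theorem exists_purification {n : Type*} [Fintype n] [DecidableEq n] {ρ : Matrix n n ℂ}
    (hρ : ρ.PosSemidef) (hρ1 : ρ.trace = 1) :
    ∃ (k : ℕ) (ψ : n × Fin k → ℂ), IsPureState ψ ∧ ∀ (A B : Matrix n n ℂ) (i : n),
      blockInner (applyLocal Bᴴ ψ) (applyLocal Aᴴ ψ) i = (Aᴴ * ρ * B) i i := by
  obtain ⟨C, hC⟩ := hρ.exists_conjTranspose_mul_self
  set ψ : n × Fin (Fintype.card n) → ℂ :=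
    fun p => star (C ((Fintype.equivFin n).symm p.2) p.1)
  have hblock : ∀ (A B : Matrix n n ℂ) (i : n),
      blockInner (applyLocal Bᴴ ψ) (applyLocal Aᴴ ψ) i = (Aᴴ * ρ * B) i i := by
    intro A B i
    have hmat : ∀ (A : Matrix n n ℂ) (a : Fin (Fintype.card n)),
        applyLocal Aᴴ ψ (i, a) = (Aᴴ * Cᴴ) i ((Fintype.equivFin n).symm a) := fun A a => rfl
    have hfac : Aᴴ * ρ * B = (Aᴴ * Cᴴ) * (Bᴴ * Cᴴ)ᴴ := by
      rw [hC, Matrix.conjTranspose_mul, Matrix.conjTranspose_conjTranspose,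
        Matrix.conjTranspose_conjTranspose]
      simp only [Matrix.mul_assoc]
    rw [hfac, Matrix.mul_apply, ← (Fintype.equivFin n).symm.sum_comp]
    simp only [blockInner, dotProduct, Pi.star_apply, hmat]
    refine Finset.sum_congr rfl fun a _ => ?_
    rw [Matrix.conjTranspose_apply, mul_comm]
  refine ⟨_, ψ, ?_, hblock⟩
  rw [IsPureState, ← sum_blockInner, ← hρ1, Matrix.trace]
  refine Finset.sum_congr rfl fun i _ => ?_
  have h := hblock 1 1 i
  rwa [Matrix.conjTranspose_one, applyLocal_one, Matrix.one_mul, Matrix.mul_one] at h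

/-- Perfect discrimination: if `diag (ρ U) = 0`, then for a purification of `ρ` every measurement
outcome leaves orthogonal conditional states of the auxiliary system. -/
theorem zero_mem_achievable {n : Type*} [Fintype n] [DecidableEq n] {U ρ : Matrix n n ℂ}
    (hρ : ρ.PosSemidef) (hρ1 : ρ.trace = 1) (hU : ∀ i, (ρ * U) i i = 0) {δ : ℝ} (hδ : 0 ≤ δ) :
    0 ∈ achievableTypeIIErrors (vonNeumann 1) (vonNeumann U) δ := by
  obtain ⟨k, ψ, hψ, hblock⟩ := exists_purification hρ hρ1
  have h := mem_achievable_of_blockProj U (δ := δ) (e := 1) (by simp) hψ ψ ?_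
  · convert h
    symm
    refine Finset.sum_eq_zero fun i _ => ?_
    have h1 := hblock U 1 i
    rw [Matrix.conjTranspose_one, applyLocal_one, Matrix.mul_one] at h1
    have h2 : (Uᴴ * ρ) i i = star ((ρ * U) i i) := by
      rw [← Matrix.conjTranspose_apply, Matrix.conjTranspose_mul, hρ.1.eq]
    have h3 : U * Matrix.diagonal (1 : n → ℂ) = U := by simp
    rw [h3, h1, h2, hU]
    simp
  · have hsum : ∑ i, ‖blockInner ψ ψ i‖ ^ 2 / (blockInner ψ ψ i).re = 1 := by
      have h1 : ∀ i, ‖blockInner ψ ψ i‖ ^ 2 / (blockInner ψ ψ i).re = (blockInner ψ ψ i).re := by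
        intro i
        rw [blockInner_self, Complex.norm_real, Complex.ofReal_re,
          Real.norm_of_nonneg (by positivity), pow_two, mul_self_div_self]
      simp only [h1]
      rw [← Complex.re_sum, sum_blockInner, hψ, Complex.one_re]
    rw [hsum]
    linarith

/-- If the density matrix `ρ` and the unitary `V = U E` satisfy `diag (V† ρ V) = diag ρ` and
`diag (V† ρ) = c diag ρ`, then for a purification of `ρ` the two conditional states of the
auxiliary system have the same weight and the same overlap `c` for every outcome. All blocks are
then copies of one problem of discriminating two vectors in a plane, in which a projection
reaches every pair of errors `1 - a²`, `(a c - b √(1 - c²))²` with `a² + b² = 1`. -/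
theorem mem_achievable_of_uniform_overlap {n : Type*} [Fintype n] [DecidableEq n]
    {U ρ : Matrix n n ℂ} {e : n → ℂ} (he : ∀ i, ‖e i‖ = 1) (hρ : ρ.PosSemidef)
    (hρ1 : ρ.trace = 1) {c : ℝ} (hc0 : 0 ≤ c) (hc1 : c ≤ 1)
    (hVρV : ∀ i, ((U * Matrix.diagonal e)ᴴ * ρ * (U * Matrix.diagonal e)) i i = ρ i i)
    (hVρ : ∀ i, ((U * Matrix.diagonal e)ᴴ * ρ) i i = c * ρ i i) {a b δ : ℝ}
    (hab : a ^ 2 + b ^ 2 = 1) (hδ : 1 - δ ≤ a ^ 2) :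
    (a * c - b * √(1 - c ^ 2)) ^ 2 ∈ achievableTypeIIErrors (vonNeumann 1) (vonNeumann U) δ := by
  obtain ⟨k, ψ, hψ, hblock⟩ := exists_purification hρ hρ1
  have hψψ : ∀ i, blockInner ψ ψ i = ρ i i := fun i => by
    have h := hblock 1 1 i
    rwa [Matrix.conjTranspose_one, applyLocal_one, Matrix.one_mul, Matrix.mul_one] at h
  set Y := applyLocal (U * Matrix.diagonal e)ᴴ ψ with hY
  have hYY : ∀ i, blockInner Y Y i = ρ i i := fun i => by rw [hY, hblock, hVρV]
  have hψY : ∀ i, blockInner ψ Y i = c * ρ i i := fun i => by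
    have h := hblock (U * Matrix.diagonal e) 1 i
    rwa [Matrix.conjTranspose_one, applyLocal_one, Matrix.mul_one, hVρ] at h
  have hρre : ∀ i, ρ i i = (((ρ i i).re : ℝ) : ℂ) := fun i => by
    rw [← hψψ, blockInner_self, Complex.ofReal_re]
  have hYψ : ∀ i, blockInner Y ψ i = c * ρ i i := fun i => by
    have h : star (blockInner ψ Y i) = blockInner Y ψ i := star_dotProduct_comm _ _
    rw [← h, hψY, hρre, star_mul', Complex.star_def, Complex.conj_ofReal, Complex.conj_ofReal]
  have htr : ∑ i, (ρ i i).re = 1 := by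
    have := congrArg Complex.re hρ1
    rwa [Matrix.trace, Complex.re_sum, Complex.one_re] at this
  have hc2 : 0 ≤ 1 - c ^ 2 := by nlinarith
  rcases hc2.eq_or_lt with hr | hr
  · -- Here `c = 1`: the two states coincide, and `Ω = a² 1` is used.
    have hc : c = 1 := by nlinarith
    have heff : IsEffect (((a ^ 2 : ℝ) : ℂ) • (1 : Matrix (n × Fin k) (n × Fin k) ℂ)) := by
      refine ⟨Matrix.PosSemidef.one.smul (by rw [Complex.zero_le_real]; positivity), ?_⟩
      have : 1 - ((a ^ 2 : ℝ) : ℂ) • (1 : Matrix (n × Fin k) (n × Fin k) ℂ) =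
          ((b ^ 2 : ℝ) : ℂ) • 1 := by
        rw [show b ^ 2 = 1 - a ^ 2 by linarith, Complex.ofReal_sub, Complex.ofReal_one, sub_smul,
          one_smul]
      rw [this]
      exact Matrix.PosSemidef.one.smul (by rw [Complex.zero_le_real]; positivity)
    have hpinch : pinch (((a ^ 2 : ℝ) : ℂ) • (1 : Matrix (n × Fin k) (n × Fin k) ℂ)) =
        ((a ^ 2 : ℝ) : ℂ) • 1 := by
      ext p q
      simp only [pinch, Matrix.of_apply]
      split_ifs with h
      · rfl
      · rw [Matrix.smul_apply, Matrix.one_apply_ne (fun hpq => h (by rw [hpq])), smul_zero]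
    have hYp : star Y ⬝ᵥ Y = 1 := by
      rw [← sum_blockInner, ← hρ1]
      exact Finset.sum_congr rfl fun i _ => hYY i
    refine ⟨k, ψ, _, hψ, heff, ?_, ?_⟩
    · rw [typeIError_eq hψ, hpinch, Matrix.smul_mulVec, Matrix.one_mulVec, dotProduct_smul, hψ,
        smul_eq_mul, mul_one, Complex.ofReal_re]
      linarith
    · rw [typeIIError_eq U he, hpinch, Matrix.smul_mulVec, Matrix.one_mulVec, dotProduct_smul,
        hYp, smul_eq_mul, mul_one, Complex.ofReal_re, ← hr, hc, Real.sqrt_zero]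
      ring
  · set r := √(1 - c ^ 2)
    have hr0 : (r : ℂ) ≠ 0 := by exact_mod_cast (Real.sqrt_pos.mpr hr).ne'
    have hr2 : (r : ℂ) ^ 2 = 1 - (c : ℂ) ^ 2 := by exact_mod_cast Real.sq_sqrt hc2
    have hab' : (a : ℂ) ^ 2 + (b : ℂ) ^ 2 = 1 := by exact_mod_cast hab
    -- `(Y - c ψ) / r` is the component of `Y` orthogonal to `ψ` in each block, normalized.
    set s : ℂ := a + b / r * c with hs
    set φ : n × Fin k → ℂ := fun p => s * ψ p - b / r * Y p with hφ
    have hlin : ∀ y i, blockInner φ y i =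
        s * blockInner ψ y i - b / r * blockInner Y y i := by
      intro y i
      have hss : star s = s := by
        simp [hs, Complex.conj_ofReal]
      have hbb : star ((b : ℂ) / r) = b / r := by simp [Complex.conj_ofReal]
      simp only [blockInner, dotProduct, Pi.star_apply, hφ, star_sub, star_mul', hss, hbb,
        Finset.mul_sum, ← Finset.sum_sub_distrib]
      refine Finset.sum_congr rfl fun a _ => ?_
      ring
    have hlin' : ∀ i, blockInner φ φ i =
        s * blockInner φ ψ i - b / r * blockInner φ Y i := by
      intro i
      simp only [blockInner, dotProduct, Pi.star_apply, Finset.mul_sum,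
        ← Finset.sum_sub_distrib]
      refine Finset.sum_congr rfl fun a _ => ?_
      simp only [hφ]
      ring
    have hφψ : ∀ i, blockInner φ ψ i = ((a * (ρ i i).re : ℝ) : ℂ) := fun i => by
      rw [hlin, hψψ, hYψ, Complex.ofReal_mul, ← hρre, hs]
      ring
    have hφY : ∀ i, blockInner φ Y i = (((a * c - b * r) * (ρ i i).re : ℝ) : ℂ) := fun i => by
      rw [hlin, hYY, hψY, Complex.ofReal_mul, ← hρre, hs]
      push_cast
      field_simp
      linear_combination (b : ℂ) * ρ i i * hr2
    have hφφ : ∀ i, blockInner φ φ i = (((ρ i i).re : ℝ) : ℂ) := fun i => by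
      rw [hlin', hφψ, hφY, Complex.ofReal_mul, Complex.ofReal_mul, ← hρre, hs]
      push_cast
      field_simp
      linear_combination (r : ℂ) * ρ i i * hab'
    have hterm : ∀ t x : ℝ, ‖((t * x : ℝ) : ℂ)‖ ^ 2 / x = t ^ 2 * x := by
      intro t x
      rw [Complex.norm_real, Real.norm_eq_abs, sq_abs, mul_pow, mul_div_assoc, pow_two x,
        mul_self_div_self]
    have h := mem_achievable_of_blockProj U (δ := δ) he hψ φ ?_
    · convert h
      rw [← hY]
      simp only [hφY, hφφ, Complex.ofReal_re, hterm]
      rw [← Finset.mul_sum, htr, mul_one]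
    · simp only [hφψ, hφφ, Complex.ofReal_re, hterm]
      rw [← Finset.mul_sum, htr, mul_one]
      exact hδ

/-! ### Duality for a single copy -/

/-- `ρ` is a density matrix: positive semidefinite of trace one. -/
def IsDensity {n : Type*} [Fintype n] (ρ : Matrix n n ℂ) : Prop :=
  ρ.PosSemidef ∧ ρ.trace = 1

theorem IsPureState.isDensity_proj {n : Type*} [Fintype n] {x : n → ℂ} (hx : IsPureState x) :
    IsDensity (proj x) := by
  refine ⟨Matrix.posSemidef_vecMulVec_self_star x, ?_⟩
  rw [proj, Matrix.trace_vecMulVec, dotProduct_comm, hx]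

theorem trace_proj_mul {n : Type*} [Fintype n] (x : n → ℂ) (A : Matrix n n ℂ) :
    (proj x * A).trace = star x ⬝ᵥ (A *ᵥ x) := by
  rw [Matrix.trace_mul_comm, proj, Matrix.mul_vecMulVec, Matrix.trace_vecMulVec, dotProduct_comm]

theorem isDensity_convexCombination {n : Type*} [Fintype n] {ρ σ : Matrix n n ℂ} (hρ : IsDensity ρ)
    (hσ : IsDensity σ) {a b : ℝ} (ha : 0 ≤ a) (hb : 0 ≤ b) (hab : a + b = 1) :
    IsDensity ((a : ℂ) • ρ + (b : ℂ) • σ) := by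
  refine ⟨(hρ.1.smul (Complex.zero_le_real.mpr ha)).add (hσ.1.smul (Complex.zero_le_real.mpr hb)),
    ?_⟩
  rw [Matrix.trace_add, Matrix.trace_smul, Matrix.trace_smul, hρ.2, hσ.2, smul_eq_mul,
    smul_eq_mul, mul_one, mul_one]
  exact_mod_cast hab

theorem exists_isDensity_minimizing {n : Type*} [Fintype n] [DecidableEq n] [Nonempty n]
    (U : Matrix n n ℂ) :
    ∃ ρ : Matrix n n ℂ, IsDensity ρ ∧ ∀ σ : Matrix n n ℂ, IsDensity σ →
      ∑ i, ‖(ρ * U) i i‖ ≤ ∑ i, ‖(σ * U) i i‖ := by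
  -- Density matrices are the products `Bᴴ * B` with `B` on the unit sphere, which is compact.
  let R : EuclideanSpace ℂ (n × n) → Matrix n n ℂ :=
    fun x => (Matrix.of fun i j => x (i, j))ᴴ * Matrix.of fun i j => x (i, j)
  have htr : ∀ x, (R x).trace = ((‖x‖ ^ 2 : ℝ) : ℂ) := by
    intro x
    rw [EuclideanSpace.norm_sq_eq, Fintype.sum_prod_type_right]
    simp [R, Matrix.trace, Matrix.mul_apply, Complex.conj_mul']
  have hR : Continuous R := by
    refine Continuous.matrix_mul (Continuous.matrix_conjTranspose ?_) ?_ <;>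
    · refine continuous_matrix fun i j => ?_
      simp only [Matrix.of_apply]
      fun_prop
  have hcont : Continuous fun x => ∑ i, ‖(R x * U) i i‖ := by
    refine continuous_finsetSum _ fun i _ => Continuous.norm ?_
    exact (hR.matrix_mul continuous_const).matrix_elem i i
  obtain ⟨x, hx, hmin⟩ := (isCompact_sphere (0 : EuclideanSpace ℂ (n × n)) 1).exists_isMinOn
    (NormedSpace.sphere_nonempty.mpr zero_le_one) hcont.continuousOn
  have hx1 : ‖x‖ = 1 := by simpa using hx
  refine ⟨R x, ⟨Matrix.posSemidef_conjTranspose_mul_self _, by rw [htr, hx1]; simp⟩,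
    fun σ hσ => ?_⟩
  obtain ⟨B, hB⟩ := hσ.1.exists_conjTranspose_mul_self
  have hRB : R (WithLp.toLp 2 fun p => B p.1 p.2) = σ := by rw [hB]; rfl
  have hnorm : ‖(WithLp.toLp 2 fun p => B p.1 p.2 : EuclideanSpace ℂ (n × n))‖ = 1 := by
    have h := htr (WithLp.toLp 2 fun p => B p.1 p.2)
    rw [hRB, hσ.2] at h
    have h2 : ‖(WithLp.toLp 2 fun p => B p.1 p.2 : EuclideanSpace ℂ (n × n))‖ ^ 2 = 1 := by
      exact_mod_cast h.symm
    exact (pow_eq_one_iff_of_nonneg (norm_nonneg _) two_ne_zero).mp h2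
  have h := hmin (show WithLp.toLp 2 (fun p => B p.1 p.2) ∈ Metric.sphere _ _ by simpa using hnorm)
  simp only [Set.mem_ofPred_eq, hRB] at h
  exact h

/-- A convex set at `ℓ¹`-distance at least `v > 0` from the origin is separated from the open
`ℓ¹`-ball of radius `v` by a functional of dual norm at most one. -/
theorem exists_contraction_separating {n : Type*} [Fintype n] [DecidableEq n] {S : Set (n → ℂ)}
    (hS : Convex ℝ S) {v : ℝ} (hv : 0 < v) (hSv : ∀ z ∈ S, v ≤ ∑ i, ‖z i‖) :
    ∃ e : n → ℂ, (∀ i, ‖e i‖ ≤ 1) ∧ ∀ z ∈ S, v ≤ (∑ i, z i * e i).re := by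
  have hball : Convex ℝ {z : n → ℂ | ∑ i, ‖z i‖ < v} := by
    intro x hx y hy a b ha hb hab
    have hle : ∑ i, ‖(a • x + b • y) i‖ ≤ a * ∑ i, ‖x i‖ + b * ∑ i, ‖y i‖ := by
      rw [Finset.mul_sum, Finset.mul_sum, ← Finset.sum_add_distrib]
      refine Finset.sum_le_sum fun i _ => (norm_add_le _ _).trans_eq ?_
      rw [Pi.smul_apply, Pi.smul_apply, norm_smul, norm_smul, Real.norm_of_nonneg ha,
        Real.norm_of_nonneg hb]
    refine hle.trans_lt ?_
    have h := convex_Iio (𝕜 := ℝ) v (show ∑ i, ‖x i‖ ∈ Set.Iio v from hx)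
      (show ∑ i, ‖y i‖ ∈ Set.Iio v from hy) ha hb hab
    simpa using h
  have hopen : IsOpen {z : n → ℂ | ∑ i, ‖z i‖ < v} := isOpen_lt (by fun_prop) continuous_const
  obtain ⟨f, s, hfs, hsf⟩ := geometric_hahn_banach_open hball hopen hS
    (Set.disjoint_left.mpr fun z hz hzS => absurd (hSv z hzS) (not_le.mpr hz))
  have hs : 0 < s := by
    have := hfs 0 (by simpa using hv)
    rwa [map_zero] at this
  -- The functional `f` is `z ↦ Re ∑ z i * g i`.
  set g : n → ℂ := fun i => (f (Pi.single i 1) : ℂ) - f (Pi.single i Complex.I) * Complex.I with hg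
  have hfg : ∀ z, f z = (∑ i, z i * g i).re := by
    intro z
    have hz : z = ∑ i, ((z i).re • (Pi.single i 1 : n → ℂ) +
        (z i).im • (Pi.single i Complex.I : n → ℂ)) := by
      ext j
      rw [Finset.sum_apply, Finset.sum_eq_single j (fun i _ hij => by
        simp [Pi.single_eq_of_ne hij.symm]) (by simp)]
      simp [Complex.re_add_im]
    conv_lhs => rw [hz]
    rw [map_sum, Complex.re_sum]
    refine Finset.sum_congr rfl fun i _ => ?_
    rw [map_add, map_smul, map_smul]
    simp [hg]
  have hgs : ∀ i, v * ‖g i‖ ≤ s := by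
    intro i
    by_contra! hlt
    have hg0 : g i ≠ 0 := fun h => by
      rw [h, norm_zero, mul_zero] at hlt
      exact lt_asymm hs hlt
    have h := hfs (Pi.single i (s / g i)) (by
      rw [Set.mem_ofPred_eq, Finset.sum_eq_single i (fun j _ hj => by
        rw [Pi.single_eq_of_ne hj, norm_zero]) (by simp), Pi.single_eq_same, norm_div,
        Complex.norm_real, Real.norm_of_nonneg hs.le, div_lt_iff₀ (norm_pos_iff.mpr hg0)]
      exact hlt)
    rw [hfg, Finset.sum_eq_single i (fun j _ hj => by
      rw [Pi.single_eq_of_ne hj, zero_mul]) (by simp), Pi.single_eq_same, div_mul_cancel₀ _ hg0,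
      Complex.ofReal_re] at h
    exact lt_irrefl _ h
  refine ⟨fun i => ((v / s : ℝ) : ℂ) * g i, fun i => ?_, fun z hz => ?_⟩
  · rw [norm_mul, Complex.norm_real, Real.norm_of_nonneg (by positivity), div_mul_eq_mul_div,
      div_le_one hs]
    exact hgs i
  · have h1 : ∑ i, z i * (((v / s : ℝ) : ℂ) * g i) = ((v / s : ℝ) : ℂ) * ∑ i, z i * g i := by
      rw [Finset.mul_sum]
      exact Finset.sum_congr rfl fun i _ => by ring
    rw [h1, Complex.re_ofReal_mul, ← hfg, div_mul_eq_mul_div, le_div_iff₀ hs]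
    exact mul_le_mul_of_nonneg_left (hsf z hz) hv.le

/-- If `Re ⟨x|U E|x⟩ ≥ v > 0` on unit vectors, for a diagonal contraction `E`, then the phases `e`
of `E` give a unitary `U e` whose eigenvalues have real part at least `v`: for a unit eigenvector
`x` with eigenvalue `λ` one has `⟨x|U E|x⟩ = λ ⟨x| |E| |x⟩`, with `⟨x| |E| |x⟩ ≤ 1`. -/
theorem exists_phases_of_contraction {n : Type*} [Fintype n] [DecidableEq n] {U : Matrix n n ℂ}
    (hU : U ∈ Matrix.unitaryGroup n ℂ) {v : ℝ} (hv : 0 < v) {g : n → ℂ} (hg : ∀ i, ‖g i‖ ≤ 1)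
    (hgv : ∀ x, IsPureState x → v ≤ (star x ⬝ᵥ ((U * Matrix.diagonal g) *ᵥ x)).re) :
    ∃ e : n → ℂ, (∀ i, ‖e i‖ = 1) ∧ ∃ W ∈ Matrix.unitaryGroup n ℂ, ∃ D : n → ℂ,
      (∀ j, ‖D j‖ = 1 ∧ v ≤ (D j).re) ∧
      U * Matrix.diagonal e = W * Matrix.diagonal D * Wᴴ := by
  have hg0 : ∀ i, g i ≠ 0 := by
    intro i hi
    have h := hgv (Pi.single i 1) (by simp [IsPureState, Pi.star_single])
    rw [← Matrix.mulVec_mulVec] at h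
    have h0 : Matrix.diagonal g *ᵥ Pi.single i 1 = 0 := by
      ext j
      rw [Matrix.mulVec_diagonal]
      by_cases hj : j = i
      · rw [hj, hi, zero_mul]; rfl
      · simp [Pi.single_eq_of_ne hj]
    rw [h0, Matrix.mulVec_zero, dotProduct_zero, Complex.zero_re] at h
    exact absurd hv (not_lt.mpr h)
  set e : n → ℂ := fun i => g i / ‖g i‖ with he
  have he1 : ∀ i, ‖e i‖ = 1 := fun i => by
    rw [he, norm_div, Complex.norm_real, norm_norm, div_self (norm_ne_zero_iff.mpr (hg0 i))]
  have hge : Matrix.diagonal g = Matrix.diagonal e * Matrix.diagonal fun i => (‖g i‖ : ℂ) := by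
    rw [Matrix.diagonal_mul_diagonal]
    congr 1
    ext i
    have : (‖g i‖ : ℂ) ≠ 0 := by exact_mod_cast norm_ne_zero_iff.mpr (hg0 i)
    rw [he, div_mul_cancel₀ _ this]
  have hV := mul_diagonal_mem_unitaryGroup hU he1
  obtain ⟨W, hW, D, hD, hVW⟩ := exists_unitary_diagonalization hV
  refine ⟨e, he1, W, hW, D, fun j => ⟨hD j, ?_⟩, hVW⟩
  have hW1 : Wᴴ * W = 1 := Matrix.mem_unitaryGroup_iff'.mp hW
  have hsingle : IsPureState (Pi.single j 1 : n → ℂ) := by simp [IsPureState, Pi.star_single]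
  set x := W *ᵥ Pi.single j 1 with hx
  have hxp : IsPureState x := hsingle.mulVec hW
  have hVx : (U * Matrix.diagonal e)ᴴ *ᵥ x = star (D j) • x := by
    rw [hVW, hx, Matrix.conjTranspose_mul, Matrix.conjTranspose_mul,
      Matrix.conjTranspose_conjTranspose, Matrix.mulVec_mulVec, mul_assoc, mul_assoc, hW1, mul_one,
      ← Matrix.mulVec_mulVec, Matrix.diagonal_conjTranspose, Matrix.diagonal_mulVec_single,
      ← Matrix.mulVec_smul, ← Pi.single_smul]
    simp
  have hval : star x ⬝ᵥ ((U * Matrix.diagonal g) *ᵥ x) =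
      D j * ((∑ i, ‖g i‖ * ‖x i‖ ^ 2 : ℝ) : ℂ) := by
    rw [hge, ← mul_assoc, ← Matrix.mulVec_mulVec, star_dotProduct_mulVec, hVx, star_smul,
      star_star, smul_dotProduct, smul_eq_mul]
    congr 1
    rw [dotProduct]
    push_cast
    refine Finset.sum_congr rfl fun i _ => ?_
    rw [Matrix.mulVec_diagonal, ← Complex.conj_mul', Pi.star_apply, Complex.star_def]
    ring
  have h := hgv x hxp
  rw [hval, Complex.re_mul_ofReal] at h
  have h0 : 0 ≤ ∑ i, ‖g i‖ * ‖x i‖ ^ 2 := by positivity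
  have h1 : ∑ i, ‖g i‖ * ‖x i‖ ^ 2 ≤ 1 := by
    rw [← (isPureState_iff x).mp hxp]
    exact Finset.sum_le_sum fun i _ => mul_le_of_le_one_left (by positivity) (hg i)
  have hD0 : 0 ≤ (D j).re := by
    by_contra! hneg
    exact absurd h (not_le.mpr ((mul_nonpos_of_nonpos_of_nonneg hneg.le h0).trans_lt hv))
  exact h.trans (mul_le_of_le_one_right hD0 h1)

theorem _root_.Matrix.PosSemidef.apply_eq_zero {n : Type*} [Fintype n] [DecidableEq n]
    {M : Matrix n n ℂ} (hM : M.PosSemidef) {j : n} (hj : M j j = 0) (k : n) :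
    M j k = 0 ∧ M k j = 0 := by
  have h := hM.norm_dotProduct_mulVec_le (Pi.single j 1) (Pi.single k 1)
  simp only [Pi.star_single, star_one, Matrix.mulVec_single, single_dotProduct, one_mul,
    MulOpposite.op_one, one_smul, Matrix.col_apply, hj, Complex.zero_re, Real.sqrt_zero,
    zero_mul] at h
  have h0 : M j k = 0 := norm_le_zero_iff.mp h
  refine ⟨h0, ?_⟩
  rw [← hM.1.apply k j, h0, star_zero]

/-- Let `V` be unitary with eigenvalues of real part at least `Re w`, where `‖w‖ = 1`, and let the
density matrix `ρ` satisfy `∑ i, |(ρ V) i i| ≤ Re w`. Comparing with `Re tr (ρ V)` shows that `ρ`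
is supported on the eigenspaces of `w` and `star w` and that `diag (ρ V)` is real. In
`ρ V - (ρ V)†` the off-diagonal blocks of `ρ` cancel, and what is left is `w - star w` times
the difference of the two diagonal blocks; these therefore have the same diagonal. -/
theorem exists_eigenstates_equal_diag {n : Type*} [Fintype n] [DecidableEq n]
    {V W : Matrix n n ℂ} (hW : W ∈ Matrix.unitaryGroup n ℂ) {D : n → ℂ}
    (hVW : V = W * Matrix.diagonal D * Wᴴ) {w : ℂ} (hw : ‖w‖ = 1)
    (hD : ∀ j, ‖D j‖ = 1 ∧ w.re ≤ (D j).re) {ρ : Matrix n n ℂ} (hρ : IsDensity ρ)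
    (hρV : ∑ i, ‖(ρ * V) i i‖ ≤ w.re) :
    ∃ ρ₁ ρ₂ : Matrix n n ℂ, IsDensity ρ₁ ∧ IsDensity ρ₂ ∧ ρ₁ * V = w • ρ₁ ∧
      ρ₂ * V = star w • ρ₂ ∧ ∀ i, ρ₁ i i = ρ₂ i i := by
  have hW1 : Wᴴ * W = 1 := Matrix.mem_unitaryGroup_iff'.mp hW
  have hW2 : W * Wᴴ = 1 := Matrix.mem_unitaryGroup_iff.mp hW
  obtain ⟨M, hM⟩ : ∃ M, M = Wᴴ * ρ * W := ⟨_, rfl⟩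
  have hMpsd : M.PosSemidef := hM ▸ hρ.1.conjTranspose_mul_mul_same W
  have hMtr : M.trace = 1 := by
    rw [hM, Matrix.trace_mul_cycle, hW2, Matrix.one_mul, hρ.2]
  have hρM : ρ = W * M * Wᴴ := by
    rw [hM, ← mul_assoc, ← mul_assoc, hW2, one_mul, mul_assoc, hW2, mul_one]
  have hmulV : ∀ A : Matrix n n ℂ, W * A * Wᴴ * V = W * (A * Matrix.diagonal D) * Wᴴ := by
    intro A
    rw [hVW]
    calc _ = W * A * (Wᴴ * W) * Matrix.diagonal D * Wᴴ := by simp only [mul_assoc]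
      _ = _ := by rw [hW1, mul_one]; simp only [mul_assoc]
  have hMnn : ∀ j, 0 ≤ (M j j).re := fun j => (Complex.le_def.mp hMpsd.diag_nonneg).1
  have hMre : ∀ j, M j j = (((M j j).re : ℝ) : ℂ) := fun j =>
    Complex.ext rfl (Complex.le_def.mp hMpsd.diag_nonneg).2.symm
  have hMsum : ∑ j, (M j j).re = 1 := by
    rw [← Complex.re_sum]
    exact congrArg Complex.re hMtr
  have htr : (∑ i, (ρ * V) i i).re = ∑ j, (M j j).re * (D j).re := by
    have h1 : ∑ i, (ρ * V) i i = (M * Matrix.diagonal D).trace := by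
      rw [hρM, hmulV]
      change (W * (M * Matrix.diagonal D) * Wᴴ).trace = _
      rw [Matrix.trace_mul_cycle, hW1, Matrix.one_mul]
    rw [h1, Matrix.trace, Complex.re_sum]
    refine Finset.sum_congr rfl fun j _ => ?_
    rw [Matrix.diag_apply, Matrix.mul_diagonal, hMre j, Complex.re_ofReal_mul, Complex.ofReal_re]
  have hlow : ∑ j, (M j j).re * w.re ≤ ∑ j, (M j j).re * (D j).re :=
    Finset.sum_le_sum fun j _ => mul_le_mul_of_nonneg_left (hD j).2 (hMnn j)
  have hup : ∑ i, ((ρ * V) i i).re ≤ ∑ i, ‖(ρ * V) i i‖ :=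
    Finset.sum_le_sum fun i _ => Complex.re_le_norm _
  rw [Complex.re_sum] at htr
  have hlow1 : ∑ j, (M j j).re * w.re = w.re := by rw [← Finset.sum_mul, hMsum, one_mul]
  have hsupp : ∀ j, M j j = 0 ∨ D j = w ∨ D j = star w := by
    intro j
    have h := (Finset.sum_eq_sum_iff_of_le (fun j _ =>
      mul_le_mul_of_nonneg_left (hD j).2 (hMnn j))).mp (le_antisymm hlow (by linarith)) j
      (Finset.mem_univ j)
    rcases mul_eq_mul_left_iff.mp h with h | h
    · right
      have h1 : (D j).im ^ 2 = w.im ^ 2 := by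
        have e1 := Complex.sq_norm (D j)
        have e2 := Complex.sq_norm w
        rw [(hD j).1, Complex.normSq_apply, ← h] at e1
        rw [hw, Complex.normSq_apply] at e2
        linarith
      rcases sq_eq_sq_iff_eq_or_eq_neg.mp h1 with h2 | h2
      · exact Or.inl (Complex.ext h.symm h2)
      · exact Or.inr (Complex.ext (by simpa using h.symm) (by simpa using h2))
    · left
      rw [hMre, h, Complex.ofReal_zero]
  have hreal : ∀ i, ((ρ * V) i i).im = 0 := by
    intro i
    have h := (Finset.sum_eq_sum_iff_of_le (fun i _ =>
      Complex.re_le_norm ((ρ * V) i i))).mp (le_antisymm hup (by linarith)) i (Finset.mem_univ i)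
    exact (Complex.nonneg_iff.mp (Complex.re_eq_norm.mp h)).2.symm
  by_cases hwim : w.im = 0
  · have hws : star w = w := Complex.conj_eq_iff_im.mpr hwim
    have hMD : M * Matrix.diagonal D = w • M := by
      ext j k
      rw [Matrix.mul_diagonal, Matrix.smul_apply, smul_eq_mul, mul_comm]
      rcases hsupp k with h | h | h
      · rw [(hMpsd.apply_eq_zero h j).2, mul_zero, mul_zero]
      · rw [h]
      · rw [h, hws]
    have hρw : ρ * V = w • ρ := by
      rw [hρM, hmulV, hMD, Matrix.mul_smul, Matrix.smul_mul]
    exact ⟨ρ, ρ, hρ, hρ, hρw, by rw [hws, hρw], fun _ => rfl⟩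
  · have hww : w - star w ≠ 0 := by
      intro h
      have := congrArg Complex.im h
      simp at this
      exact hwim (by linarith)
    -- `B u` is twice the diagonal block of `M` for the eigenvalue `u`.
    obtain ⟨P, hP⟩ : ∃ P : ℂ → Matrix n n ℂ, ∀ u,
        P u = Matrix.diagonal fun j => if D j = u then 1 else 0 := ⟨_, fun _ => rfl⟩
    obtain ⟨B, hB⟩ : ∃ B : ℂ → Matrix n n ℂ, ∀ u, B u = (2 : ℂ) • (P u * M * P u) :=
      ⟨_, fun _ => rfl⟩
    have hBapply : ∀ u j k, B u j k =
        2 * ((if D j = u then 1 else 0) * M j k * if D k = u then 1 else 0) := by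
      intro u j k
      rw [hB, hP, Matrix.smul_apply, Matrix.mul_diagonal, Matrix.diagonal_mul, smul_eq_mul]
    have hBpsd : ∀ u, (W * B u * Wᴴ).PosSemidef := by
      intro u
      rw [hB]
      refine Matrix.PosSemidef.mul_mul_conjTranspose_same (Matrix.PosSemidef.smul ?_ (by simp)) W
      have hPu : (P u)ᴴ = P u := by
        rw [hP, Matrix.diagonal_conjTranspose]
        congr 1
        ext j
        rw [Pi.star_apply]
        split_ifs <;> simp
      have := hMpsd.conjTranspose_mul_mul_same (P u)
      rwa [hPu] at this
    have hBV : ∀ u, W * B u * Wᴴ * V = u • (W * B u * Wᴴ) := by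
      intro u
      have h : B u * Matrix.diagonal D = u • B u := by
        ext j k
        rw [Matrix.mul_diagonal, Matrix.smul_apply, hBapply, smul_eq_mul]
        by_cases hk : D k = u
        · rw [hk]; ring
        · rw [if_neg hk]; ring
      rw [hmulV, h, Matrix.mul_smul, Matrix.smul_mul]
    have hne : w ≠ star w := fun h => hww (sub_eq_zero.mpr h)
    have hdiff : (2 : ℂ) • (M * Matrix.diagonal D - Matrix.diagonal (star D) * M) =
        (w - star w) • (B w - B (star w)) := by
      ext j k
      rw [Matrix.smul_apply, Matrix.sub_apply, Matrix.mul_diagonal, Matrix.diagonal_mul,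
        Matrix.smul_apply, Matrix.sub_apply, hBapply, hBapply, smul_eq_mul, smul_eq_mul,
        Pi.star_apply]
      rcases hsupp j with hj | hj | hj
      · rw [(hMpsd.apply_eq_zero hj k).1]; ring
      all_goals
        rcases hsupp k with hk | hk | hk
        · rw [(hMpsd.apply_eq_zero hk j).2]; ring
        all_goals
          simp only [hj, hk, if_true, if_neg hne, if_neg hne.symm, star_star]
          ring
    have hdiag : ∀ i, (W * B w * Wᴴ) i i = (W * B (star w) * Wᴴ) i i := by
      intro i
      have h1 : (2 : ℂ) • (ρ * V - (ρ * V)ᴴ) =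
          (w - star w) • (W * B w * Wᴴ - W * B (star w) * Wᴴ) := by
        have h2 : (ρ * V)ᴴ = W * (Matrix.diagonal (star D) * M) * Wᴴ := by
          rw [hρM, hmulV, Matrix.conjTranspose_mul, Matrix.conjTranspose_mul,
            Matrix.conjTranspose_mul, Matrix.conjTranspose_conjTranspose,
            Matrix.diagonal_conjTranspose, hMpsd.1.eq]
          simp only [mul_assoc]
        have h3 : ρ * V = W * (M * Matrix.diagonal D) * Wᴴ := by rw [hρM, hmulV]
        rw [h2, h3, ← Matrix.sub_mul, ← Matrix.mul_sub, ← Matrix.sub_mul, ← Matrix.mul_sub,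
          ← Matrix.smul_mul, ← Matrix.mul_smul, hdiff, Matrix.mul_smul, Matrix.smul_mul]
      have h4 := congrFun (congrFun h1 i) i
      have h5 : (ρ * V) i i - star ((ρ * V) i i) = 0 := by
        rw [sub_eq_zero, eq_comm]
        exact Complex.conj_eq_iff_im.mpr (hreal i)
      rw [Matrix.smul_apply, Matrix.sub_apply, Matrix.conjTranspose_apply, h5, smul_zero,
        Matrix.smul_apply, Matrix.sub_apply, smul_eq_mul] at h4
      exact sub_eq_zero.mp ((mul_eq_zero.mp h4.symm).resolve_left hww)
    have htrB : ∀ u, (W * B u * Wᴴ).trace = (B u).trace := fun u => by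
      rw [Matrix.trace_mul_cycle, hW1, Matrix.one_mul]
    have htreq : (W * B w * Wᴴ).trace = (W * B (star w) * Wᴴ).trace :=
      Finset.sum_congr rfl fun i _ => hdiag i
    have htradd : (W * B w * Wᴴ).trace + (W * B (star w) * Wᴴ).trace = 2 := by
      rw [htrB, htrB, ← Matrix.trace_add, ← mul_one (2 : ℂ), ← hMtr, ← smul_eq_mul,
        ← Matrix.trace_smul]
      refine Finset.sum_congr rfl fun j _ => ?_
      rw [Matrix.diag_apply, Matrix.diag_apply, Matrix.add_apply, hBapply, hBapply,
        Matrix.smul_apply, smul_eq_mul]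
      rcases hsupp j with hj | hj | hj
      · rw [hj]; ring
      · simp only [hj, if_true, if_neg hne]; ring
      · simp only [hj, if_true, if_neg hne.symm]; ring
    have htr2 : (W * B (star w) * Wᴴ).trace = 1 := by
      rw [htreq] at htradd
      linear_combination htradd / 2
    exact ⟨W * B w * Wᴴ, W * B (star w) * Wᴴ, ⟨hBpsd w, htreq.trans htr2⟩, ⟨hBpsd _, htr2⟩,
      hBV w, hBV _, hdiag⟩

/-- The single-copy dichotomy: either the measurements are perfectly discriminated by some `ρ`, or
some diagonal unitary `E` confines the spectrum of `U E` to an arc of length less than `π`, whose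
endpoints have eigenstates with the same diagonal. -/
theorem perfect_or_exists_eigenstates {n : Type*} [Fintype n] [DecidableEq n] [Nonempty n]
    {U : Matrix n n ℂ} (hU : U ∈ Matrix.unitaryGroup n ℂ) :
    (∃ ρ : Matrix n n ℂ, IsDensity ρ ∧ ∀ i, (ρ * U) i i = 0) ∨
    ∃ e : n → ℂ, (∀ i, ‖e i‖ = 1) ∧ ∃ W ∈ Matrix.unitaryGroup n ℂ, ∃ D : n → ℂ, ∃ θ : ℝ,
      0 ≤ θ ∧ θ < Real.pi / 2 ∧ (∀ j, ‖D j‖ = 1 ∧ Real.cos θ ≤ (D j).re) ∧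
      U * Matrix.diagonal e = W * Matrix.diagonal D * Wᴴ ∧
      ∃ ρ₁ ρ₂ : Matrix n n ℂ, IsDensity ρ₁ ∧ IsDensity ρ₂ ∧
        ρ₁ * (U * Matrix.diagonal e) = Complex.exp (θ * Complex.I) • ρ₁ ∧
        ρ₂ * (U * Matrix.diagonal e) = Complex.exp (-(θ * Complex.I)) • ρ₂ ∧
        ∀ i, ρ₁ i i = ρ₂ i i := by
  obtain ⟨ρ, hρ, hmin⟩ := exists_isDensity_minimizing U
  obtain ⟨v, hv⟩ : ∃ v, v = ∑ i, ‖(ρ * U) i i‖ := ⟨_, rfl⟩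
  have hv0 : 0 ≤ v := by rw [hv]; positivity
  rcases hv0.eq_or_lt with h0 | h0
  · left
    refine ⟨ρ, hρ, fun i => ?_⟩
    rw [← h0, eq_comm, Finset.sum_eq_zero_iff_of_nonneg fun i _ => norm_nonneg _] at hv
    exact norm_eq_zero.mp (hv i (Finset.mem_univ i))
  · right
    have hconv : Convex ℝ {z : n → ℂ | ∃ σ, IsDensity σ ∧ z = (σ * U).diag} := by
      rintro _ ⟨σ, hσ, rfl⟩ _ ⟨τ, hτ, rfl⟩ a b ha hb hab
      refine ⟨_, isDensity_convexCombination hσ hτ ha hb hab, ?_⟩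
      rw [Matrix.add_mul, Matrix.diag_add, Matrix.smul_mul, Matrix.smul_mul, Matrix.diag_smul,
        Matrix.diag_smul]
      rfl
    obtain ⟨g, hg, hgv⟩ := exists_contraction_separating hconv h0 (by
      rintro _ ⟨σ, hσ, rfl⟩
      rw [hv]
      exact hmin σ hσ)
    obtain ⟨e, he, W, hW, D, hD, hVW⟩ := exists_phases_of_contraction hU h0 hg (by
      intro x hx
      have h := hgv _ ⟨proj x, hx.isDensity_proj, rfl⟩
      have h2 : ∑ i, (proj x * U).diag i * g i = (proj x * (U * Matrix.diagonal g)).trace := by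
        rw [← Matrix.mul_assoc, Matrix.trace]
        refine Finset.sum_congr rfl fun i _ => ?_
        rw [Matrix.diag_apply, Matrix.diag_apply, Matrix.mul_diagonal]
      rwa [h2, trace_proj_mul] at h)
    obtain ⟨j⟩ : Nonempty n := inferInstance
    have hv1 : v ≤ 1 := (hD j).2.trans ((Complex.re_le_norm _).trans_eq (hD j).1)
    have hcos : Real.cos (Real.arccos v) = v := Real.cos_arccos (by linarith) hv1
    obtain ⟨ρ₁, ρ₂, h1, h2, h3, h4, h5⟩ := exists_eigenstates_equal_diag hW hVW
      (w := Complex.exp (Real.arccos v * Complex.I)) (Complex.norm_exp_ofReal_mul_I _)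
      (fun j => by rw [Complex.exp_ofReal_mul_I_re, hcos]; exact hD j) hρ (by
        rw [Complex.exp_ofReal_mul_I_re, hcos, hv]
        refine Finset.sum_le_sum fun i _ => ?_
        rw [← Matrix.mul_assoc, Matrix.mul_diagonal, norm_mul, he, mul_one])
    refine ⟨e, he, W, hW, D, Real.arccos v, Real.arccos_nonneg v,
      Real.arccos_lt_pi_div_two.mpr h0, fun j => by rw [hcos]; exact hD j, hVW, ρ₁, ρ₂, h1, h2,
      h3, ?_, h5⟩
    rw [h4, Complex.star_def, ← Complex.exp_conj, map_mul, Complex.conj_ofReal, Complex.conj_I,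
      mul_neg]

/-! ### Tensor products over the copies -/

/-- The tensor product `A 0 ⊗ ⋯ ⊗ A (N - 1)` in the product basis. -/
def tensorProd {d N : ℕ} (A : Fin N → Matrix (Fin d) (Fin d) ℂ) :
    Matrix (Fin N → Fin d) (Fin N → Fin d) ℂ :=
  Matrix.of fun i j => ∏ k, A k (i k) (j k)

theorem tensorPower_eq_tensorProd {d : ℕ} (A : Matrix (Fin d) (Fin d) ℂ) (N : ℕ) :
    tensorPower A N = tensorProd fun _ => A := rfl

theorem tensorProd_mul {d N : ℕ} (A B : Fin N → Matrix (Fin d) (Fin d) ℂ) :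
    tensorProd A * tensorProd B = tensorProd fun k => A k * B k := by
  ext i j
  simp only [tensorProd, Matrix.mul_apply, Matrix.of_apply, ← Finset.prod_mul_distrib]
  rw [Finset.prod_univ_sum, Fintype.piFinset_univ]

theorem tensorProd_conjTranspose {d N : ℕ} (A : Fin N → Matrix (Fin d) (Fin d) ℂ) :
    (tensorProd A)ᴴ = tensorProd fun k => (A k)ᴴ := by
  ext i j
  simp [tensorProd, Matrix.conjTranspose_apply]

theorem tensorProd_smul {d N : ℕ} (c : Fin N → ℂ) (A : Fin N → Matrix (Fin d) (Fin d) ℂ) :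
    (tensorProd fun k => c k • A k) = (∏ k, c k) • tensorProd A := by
  ext i j
  simp [tensorProd, Finset.prod_mul_distrib]

theorem trace_tensorProd {d N : ℕ} (A : Fin N → Matrix (Fin d) (Fin d) ℂ) :
    (tensorProd A).trace = ∏ k, (A k).trace := by
  simp only [Matrix.trace, Matrix.diag_apply, tensorProd, Matrix.of_apply]
  rw [Finset.prod_univ_sum, Fintype.piFinset_univ]

theorem IsDensity.tensorProd {d N : ℕ} {A : Fin N → Matrix (Fin d) (Fin d) ℂ}
    (hA : ∀ k, IsDensity (A k)) : IsDensity (tensorProd A) := by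
  refine ⟨?_, by rw [trace_tensorProd]; exact Finset.prod_eq_one fun k _ => (hA k).2⟩
  choose B hB using fun k => (hA k).1.exists_conjTranspose_mul_self
  have h : QuantumCertification.tensorProd A =
      (QuantumCertification.tensorProd B)ᴴ * QuantumCertification.tensorProd B := by
    rw [tensorProd_conjTranspose, tensorProd_mul, funext hB]
  rw [h]
  exact Matrix.posSemidef_conjTranspose_mul_self _

theorem tensorPower_mul {d : ℕ} (A B : Matrix (Fin d) (Fin d) ℂ) (N : ℕ) :
    tensorPower A N * tensorPower B N = tensorPower (A * B) N :=
  tensorProd_mul _ _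

theorem tensorPower_conjTranspose {d : ℕ} (A : Matrix (Fin d) (Fin d) ℂ) (N : ℕ) :
    (tensorPower A N)ᴴ = tensorPower Aᴴ N :=
  tensorProd_conjTranspose _

theorem tensorPower_diagonal {d : ℕ} (e : Fin d → ℂ) (N : ℕ) :
    tensorPower (Matrix.diagonal e) N =
      Matrix.diagonal fun i : Fin N → Fin d => ∏ k, e (i k) := by
  ext i j
  rw [tensorPower, Matrix.of_apply]
  by_cases h : i = j
  · subst h
    simp
  · obtain ⟨k, hk⟩ := Function.ne_iff.mp h
    rw [Matrix.diagonal_apply_ne _ h]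
    exact Finset.prod_eq_zero (Finset.mem_univ k) (Matrix.diagonal_apply_ne _ hk)

theorem tensorPower_one {d : ℕ} (N : ℕ) :
    tensorPower (1 : Matrix (Fin d) (Fin d) ℂ) N = 1 := by
  rw [← Matrix.diagonal_one, tensorPower_diagonal]
  simp

theorem tensorPower_mem_unitaryGroup {d : ℕ} {A : Matrix (Fin d) (Fin d) ℂ}
    (hA : A ∈ Matrix.unitaryGroup (Fin d) ℂ) (N : ℕ) :
    tensorPower A N ∈ Matrix.unitaryGroup (Fin N → Fin d) ℂ := by
  have h : A * Aᴴ = 1 := Matrix.mem_unitaryGroup_iff.mp hA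
  rw [Matrix.mem_unitaryGroup_iff, Matrix.star_eq_conjTranspose, tensorPower_conjTranspose,
    tensorPower_mul, h, tensorPower_one]

theorem norm_prod_eq_one {d N : ℕ} {e : Fin d → ℂ} (he : ∀ i, ‖e i‖ = 1) (i : Fin N → Fin d) :
    ‖∏ k, e (i k)‖ = 1 := by
  rw [norm_prod]
  exact Finset.prod_eq_one fun k _ => he _

/-- If the spectrum of `V` lies in the arc `[-θ, θ]` and `N θ ≤ π / 2`, then that of `V^{⊗N}` lies
in the arc `[-N θ, N θ]`, so that its numerical range has real part at least `cos (N θ)`. -/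
theorem cos_le_norm_tensorPower {d N : ℕ} {W V : Matrix (Fin d) (Fin d) ℂ} {D : Fin d → ℂ}
    (hW : W ∈ Matrix.unitaryGroup (Fin d) ℂ) (hVW : V = W * Matrix.diagonal D * Wᴴ) {θ : ℝ}
    (hθ : 0 ≤ θ) (hD : ∀ j, ‖D j‖ = 1 ∧ Real.cos θ ≤ (D j).re) (hNθ : N * θ ≤ Real.pi / 2)
    (hθπ : θ ≤ Real.pi) {ψ : (Fin N → Fin d) → ℂ} (hψ : IsPureState ψ) :
    Real.cos (N * θ) ≤ ‖star ψ ⬝ᵥ (tensorPower V N *ᵥ ψ)‖ := by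
  have harg : ∀ j, |Complex.arg (D j)| ≤ θ := by
    intro j
    have h0 : D j ≠ 0 := norm_ne_zero_iff.mp (by rw [(hD j).1]; exact one_ne_zero)
    have h := (hD j).2
    rw [← div_one (D j).re, ← (hD j).1, ← Complex.cos_arg h0, ← Real.cos_abs (Complex.arg _)] at h
    exact (Real.strictAntiOn_cos.le_iff_ge ⟨hθ, hθπ⟩
      ⟨abs_nonneg _, Complex.abs_arg_le_pi _⟩).mp h
  have hexp : ∀ j, D j = Complex.exp (Complex.arg (D j) * Complex.I) := by
    intro j
    have h := Complex.norm_mul_exp_arg_mul_I (D j)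
    rw [(hD j).1, Complex.ofReal_one, one_mul] at h
    exact h.symm
  have hre : ∀ i : Fin N → Fin d, Real.cos (N * θ) ≤ (∏ k, D (i k)).re := by
    intro i
    have h1 : ∏ k, D (i k) = Complex.exp ((∑ k, Complex.arg (D (i k)) : ℝ) * Complex.I) := by
      rw [Complex.ofReal_sum, Finset.sum_mul, Complex.exp_sum]
      exact Finset.prod_congr rfl fun k _ => hexp _
    have h2 : |∑ k, Complex.arg (D (i k))| ≤ N * θ := by
      refine (Finset.abs_sum_le_sum_abs _ _).trans
        ((Finset.sum_le_sum fun k _ => harg (i k)).trans_eq ?_)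
      simp
    rw [h1, Complex.exp_ofReal_mul_I_re, ← Real.cos_abs (∑ k, _)]
    exact Real.cos_le_cos_of_nonneg_of_le_pi (abs_nonneg _) (by linarith [Real.pi_pos]) h2
  have hVN : tensorPower V N = tensorPower W N *
      Matrix.diagonal (fun i : Fin N → Fin d => ∏ k, D (i k)) * (tensorPower W N)ᴴ := by
    rw [tensorPower_conjTranspose, ← tensorPower_diagonal, tensorPower_mul, tensorPower_mul, ← hVW]
  refine le_trans ?_ (Complex.re_le_norm _)
  rw [hVN, star_dotProduct_diagonalized_mulVec, Complex.re_sum]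
  have hpure := (isPureState_iff _).mp
    (hψ.mulVec (conjTranspose_mem_unitaryGroup (tensorPower_mem_unitaryGroup hW N)))
  calc Real.cos (N * θ) = ∑ i, ‖((tensorPower W N)ᴴ *ᵥ ψ) i‖ ^ 2 * Real.cos (N * θ) := by
        rw [← Finset.sum_mul, hpure, one_mul]
    _ ≤ _ := Finset.sum_le_sum fun i _ => by
        rw [Complex.re_ofReal_mul]
        exact mul_le_mul_of_nonneg_left (hre i) (sq_nonneg _)

/-- Products of `j` copies of `ρ₁` and `N - j` copies of `ρ₂`, and vice versa, are eigenstates of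
`V^{⊗N}` with conjugate eigenvalues `exp (± i (2 j - N) θ)` and have the same diagonal; their
average turns the eigenvalues into `cos ((2 j - N) θ)`. -/
theorem exists_density_cos {d N : ℕ} {V ρ₁ ρ₂ : Matrix (Fin d) (Fin d) ℂ} {θ : ℝ}
    (h₁ : IsDensity ρ₁) (h₂ : IsDensity ρ₂)
    (hV₁ : ρ₁ * V = Complex.exp (θ * Complex.I) • ρ₁)
    (hV₂ : ρ₂ * V = Complex.exp (-(θ * Complex.I)) • ρ₂) (h₁₂ : ∀ i, ρ₁ i i = ρ₂ i i)
    {j : ℕ} (hj : j ≤ N) :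
    ∃ σ : Matrix (Fin N → Fin d) (Fin N → Fin d) ℂ, IsDensity σ ∧
      (∀ i, σ i i = ∏ k, ρ₁ (i k) (i k)) ∧
      (∀ i, (σ * tensorPower V N) i i =
        (Real.cos ((2 * j - N) * θ) : ℂ) * ∏ k, ρ₁ (i k) (i k)) ∧
      (tensorPower V N)ᴴ * σ * tensorPower V N = σ := by
  have hcard : (Finset.univ.filter fun k : Fin N => k.val < j).card = j := by
    rw [Fin.card_filter_val_lt, min_eq_right hj]
  have hcard' : (Finset.univ.filter fun k : Fin N => ¬ k.val < j).card = N - j := by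
    have := Finset.card_filter_add_card_filter_not (s := Finset.univ) (fun k : Fin N => k.val < j)
    rw [hcard, Finset.card_univ, Fintype.card_fin] at this
    omega
  -- the two kinds of product states, with opposite angles
  have key : ∀ (t : ℝ) (α β : Matrix (Fin d) (Fin d) ℂ), IsDensity α → IsDensity β →
      α * V = Complex.exp (t * Complex.I) • α → β * V = Complex.exp (-(t * Complex.I)) • β →
      (∀ i, α i i = ρ₁ i i) → (∀ i, β i i = ρ₁ i i) →
      ∃ σ : Matrix (Fin N → Fin d) (Fin N → Fin d) ℂ, IsDensity σ ∧
        (∀ i, σ i i = ∏ k, ρ₁ (i k) (i k)) ∧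
        σ * tensorPower V N = Complex.exp (((2 * j - N) * t : ℝ) * Complex.I) • σ ∧
        (tensorPower V N)ᴴ * σ * tensorPower V N = σ := by
    intro t α β hα hβ hαV hβV hαd hβd
    set A : Fin N → Matrix (Fin d) (Fin d) ℂ := fun k => if k.val < j then α else β with hA
    have hdens : IsDensity (tensorProd A) := IsDensity.tensorProd fun k => by
      simp only [hA]
      split_ifs
      exacts [hα, hβ]
    have heig : tensorProd A * tensorPower V N =
        Complex.exp (((2 * j - N) * t : ℝ) * Complex.I) • tensorProd A := by
      have h1 : ∀ k, A k * V =
          (if k.val < j then Complex.exp (t * Complex.I) else Complex.exp (-(t * Complex.I))) •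
            A k := by
        intro k
        simp only [hA]
        split_ifs
        exacts [hαV, hβV]
      rw [tensorPower_eq_tensorProd, tensorProd_mul, funext h1, tensorProd_smul, Finset.prod_ite,
        Finset.prod_const, Finset.prod_const, hcard, hcard', ← Complex.exp_nat_mul,
        ← Complex.exp_nat_mul, ← Complex.exp_add]
      congr 2
      push_cast [Nat.cast_sub hj]
      ring
    refine ⟨tensorProd A, hdens, fun i => ?_, heig, ?_⟩
    · rw [tensorProd, Matrix.of_apply]
      refine Finset.prod_congr rfl fun k _ => ?_
      simp only [hA]
      split_ifs
      exacts [hαd _, hβd _]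
    · have h2 := congrArg Matrix.conjTranspose heig
      rw [Matrix.conjTranspose_mul, Matrix.conjTranspose_smul, hdens.1.1.eq] at h2
      rw [h2, Matrix.smul_mul, heig, smul_smul, Complex.star_def, Complex.conj_mul',
        Complex.norm_exp_ofReal_mul_I]
      simp
  obtain ⟨σ, hσ, hσd, hσV, hσc⟩ := key θ ρ₁ ρ₂ h₁ h₂ hV₁ hV₂ (fun _ => rfl)
    (fun i => (h₁₂ i).symm)
  obtain ⟨τ, hτ, hτd, hτV, hτc⟩ := key (-θ) ρ₂ ρ₁ h₂ h₁ (by simpa using hV₂) (by simpa using hV₁)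
    (fun i => (h₁₂ i).symm) (fun _ => rfl)
  refine ⟨_, isDensity_convexCombination hσ hτ (a := 1 / 2) (b := 1 / 2) (by norm_num) (by norm_num)
    (by norm_num), fun i => ?_, fun i => ?_, ?_⟩
  · rw [Matrix.add_apply, Matrix.smul_apply, Matrix.smul_apply, hσd, hτd, smul_eq_mul]
    push_cast
    ring
  · rw [Matrix.add_mul, Matrix.smul_mul, Matrix.smul_mul, hσV, hτV, Matrix.add_apply,
      Matrix.smul_apply, Matrix.smul_apply, Matrix.smul_apply, Matrix.smul_apply, hσd, hτd,
      Complex.ofReal_cos, Complex.cos, mul_neg]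
    simp only [smul_eq_mul]
    push_cast
    ring_nf
  · rw [Matrix.mul_add, Matrix.add_mul, Matrix.mul_smul, Matrix.smul_mul, hσc, Matrix.mul_smul,
      Matrix.smul_mul, hτc]

/-- Once `N θ ≥ π / 2`, the numbers `cos ((2 j - N) θ)` take both signs: consecutive angles differ
by `2 θ < π`, so the first one beyond `π / 2` is at most `3 π / 2`. -/
theorem exists_cos_nonneg_cos_nonpos {N : ℕ} {θ : ℝ} (hθ : 0 ≤ θ) (hθπ : θ < Real.pi / 2)
    (hNθ : Real.pi / 2 ≤ N * θ) :
    ∃ j₀ ≤ N, ∃ j₁ ≤ N, 0 ≤ Real.cos ((2 * j₀ - N) * θ) ∧ Real.cos ((2 * j₁ - N) * θ) ≤ 0 := by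
  have hπ := Real.pi_pos
  have hN0 : N ≠ 0 := by
    rintro rfl
    simp at hNθ
    linarith
  refine ⟨(N + 1) / 2, by omega, ?_⟩
  have hex : ∃ j : ℕ, Real.pi / 2 ≤ (2 * j - N) * θ := ⟨N, by linarith⟩
  classical
  refine ⟨Nat.find hex, Nat.find_min' hex (by linarith), ?_, ?_⟩
  · rcases Nat.even_or_odd' N with ⟨m, hm | hm⟩
    · have : (N + 1) / 2 = m := by omega
      rw [this, hm]
      push_cast
      simp
    · have : (N + 1) / 2 = m + 1 := by omega
      rw [this, hm]
      push_cast
      refine Real.cos_nonneg_of_neg_pi_div_two_le_of_le ?_ ?_ <;> nlinarith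
  · have hspec := Nat.find_spec hex
    obtain ⟨j, hj⟩ : ∃ j, Nat.find hex = j + 1 := by
      refine Nat.exists_eq_succ_of_ne_zero fun h0 => ?_
      rw [h0] at hspec
      push_cast at hspec
      nlinarith [mul_nonneg (Nat.cast_nonneg (α := ℝ) N) hθ]
    have hmin := Nat.find_min hex (m := j) (by omega)
    rw [hj] at hspec ⊢
    push_cast at hspec hmin ⊢
    refine Real.cos_nonpos_of_pi_div_two_le_of_le hspec ?_
    nlinarith

/-- Perfect discrimination with `N ≥ π / (2 θ)` copies: a mixture of two averages of product
eigenstates has vanishing `diag (σ V^{⊗N})`. -/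
theorem zero_mem_achievable_tensorPower {d N : ℕ} {U ρ₁ ρ₂ : Matrix (Fin d) (Fin d) ℂ}
    {e : Fin d → ℂ} (he : ∀ i, ‖e i‖ = 1) {θ : ℝ} (hθ : 0 ≤ θ) (hθπ : θ < Real.pi / 2)
    (h₁ : IsDensity ρ₁) (h₂ : IsDensity ρ₂)
    (hV₁ : ρ₁ * (U * Matrix.diagonal e) = Complex.exp (θ * Complex.I) • ρ₁)
    (hV₂ : ρ₂ * (U * Matrix.diagonal e) = Complex.exp (-(θ * Complex.I)) • ρ₂)
    (h₁₂ : ∀ i, ρ₁ i i = ρ₂ i i) (hNθ : Real.pi / 2 ≤ N * θ) {δ : ℝ} (hδ : 0 ≤ δ) :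
    0 ∈ achievableTypeIIErrors (vonNeumann 1) (vonNeumann (tensorPower U N)) δ := by
  obtain ⟨j₀, hj₀, j₁, hj₁, hc₀, hc₁⟩ := exists_cos_nonneg_cos_nonpos hθ hθπ hNθ
  obtain ⟨σ, hσ, -, hσV, -⟩ := exists_density_cos h₁ h₂ hV₁ hV₂ h₁₂ hj₀
  obtain ⟨τ, hτ, -, hτV, -⟩ := exists_density_cos h₁ h₂ hV₁ hV₂ h₁₂ hj₁
  obtain ⟨a, b, ha, hb, hab, h0⟩ : (0 : ℝ) ∈ segment ℝ (Real.cos ((2 * j₁ - N) * θ))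
      (Real.cos ((2 * j₀ - N) * θ)) := by
    rw [segment_eq_Icc (hc₁.trans hc₀)]
    exact ⟨hc₁, hc₀⟩
  have hdens := isDensity_convexCombination hτ hσ ha hb hab
  refine zero_mem_achievable hdens.1 hdens.2 (fun i => ?_) hδ
  have hV : tensorPower (U * Matrix.diagonal e) N =
      tensorPower U N * Matrix.diagonal fun i : Fin N → Fin d => ∏ k, e (i k) := by
    rw [← tensorPower_diagonal, tensorPower_mul]
  have hzero : (((a : ℂ) • τ + (b : ℂ) • σ) * tensorPower (U * Matrix.diagonal e) N) i i = 0 := by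
    have h0' : (a : ℂ) * (Real.cos ((2 * j₁ - N) * θ) : ℂ) +
        b * (Real.cos ((2 * j₀ - N) * θ) : ℂ) = 0 := by exact_mod_cast h0
    rw [Matrix.add_mul, Matrix.smul_mul, Matrix.smul_mul, Matrix.add_apply, Matrix.smul_apply,
      Matrix.smul_apply, hσV, hτV, smul_eq_mul, smul_eq_mul]
    linear_combination (∏ k, ρ₁ (i k) (i k)) * h0'
  rw [hV, ← Matrix.mul_assoc, Matrix.mul_diagonal] at hzero
  exact (mul_eq_zero.mp hzero).resolve_right
    (norm_ne_zero_iff.mp (by rw [norm_prod_eq_one he]; exact one_ne_zero))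

/-! ### The minimized error -/

/-- Some strategy has a type II error of at most `ν²_{√(1-δ)}(U^{⊗N} E^{⊗N})` for some diagonal
unitary `E`; by `nu_sq_le_of_mem_achievable` it is then optimal. -/
theorem exists_achievable_le_nu_sq {d N : ℕ} (hd : 2 ≤ d) (hN : 1 ≤ N)
    {U : Matrix (Fin d) (Fin d) ℂ} (hU : U ∈ Matrix.unitaryGroup (Fin d) ℂ) {δ : ℝ}
    (hδ0 : 0 ≤ δ) (hδ1 : δ ≤ 1) :
    ∃ p ∈ achievableTypeIIErrors (vonNeumann 1) (vonNeumann (tensorPower U N)) δ,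
      ∃ e : Fin d → ℂ, (∀ i, ‖e i‖ = 1) ∧ p ≤ nu ((√(1 - δ) : ℝ) : ℂ)
        (tensorPower U N * tensorPower (Matrix.diagonal e) N) ^ 2 := by
  have : Nontrivial (Fin d) := Fin.nontrivial_iff_two_le.mpr hd
  have : Nonempty (Fin N) := ⟨⟨0, hN⟩⟩
  rcases perfect_or_exists_eigenstates hU with
    ⟨ρ, hρ, hρU⟩ | ⟨e, he, W, hW, D, θ, hθ, hθπ, hD, hVW, ρ₁, ρ₂, h₁, h₂, hV₁, hV₂, h₁₂⟩
  · refine ⟨0, ?_, 1, by simp, sq_nonneg _⟩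
    have hdens : IsDensity (tensorPower ρ N) := IsDensity.tensorProd fun _ => hρ
    refine zero_mem_achievable hdens.1 hdens.2 (fun i => ?_) hδ0
    rw [tensorPower_mul, tensorPower, Matrix.of_apply]
    exact Finset.prod_eq_zero (Finset.mem_univ ⟨0, hN⟩) (hρU _)
  · rcases le_total (Real.pi / 2) (N * θ) with hNθ | hNθ
    · exact ⟨0, zero_mem_achievable_tensorPower he hθ hθπ h₁ h₂ hV₁ hV₂ h₁₂ hNθ hδ0, 1, by simp,
        sq_nonneg _⟩
    · have hc0 : 0 ≤ Real.cos (N * θ) := Real.cos_nonneg_of_neg_pi_div_two_le_of_le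
        (by have := mul_nonneg (Nat.cast_nonneg (α := ℝ) N) hθ; linarith [Real.pi_pos]) hNθ
      have hc1 := Real.cos_le_one (N * θ)
      have hV : tensorPower U N * tensorPower (Matrix.diagonal e) N =
          tensorPower (U * Matrix.diagonal e) N := tensorPower_mul _ _ _
      have hE : tensorPower (Matrix.diagonal e) N =
          Matrix.diagonal fun i : Fin N → Fin d => ∏ k, e (i k) := tensorPower_diagonal _ _
      obtain ⟨σ, hσ, hσd, hσV, hσc⟩ := exists_density_cos h₁ h₂ hV₁ hV₂ h₁₂ (le_refl N)
      have hangle : ((2 * N - N : ℝ)) * θ = N * θ := by ring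
      rw [hangle] at hσV
      set c := Real.cos (N * θ)
      have hVσ : ∀ i, ((tensorPower (U * Matrix.diagonal e) N)ᴴ * σ) i i = c * σ i i := by
        intro i
        have h := Matrix.conjTranspose_apply (σ * tensorPower (U * Matrix.diagonal e) N) i i
        rw [Matrix.conjTranspose_mul, hσ.1.1.eq, hσV, ← hσd, star_mul', hσ.1.1.apply,
          Complex.star_def, Complex.conj_ofReal] at h
        exact h
      have hach : ∀ {a b : ℝ}, a ^ 2 + b ^ 2 = 1 → 1 - δ ≤ a ^ 2 →
          (a * c - b * √(1 - c ^ 2)) ^ 2 ∈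
            achievableTypeIIErrors (vonNeumann 1) (vonNeumann (tensorPower U N)) δ := by
        intro a b hab ha
        refine mem_achievable_of_uniform_overlap (fun i => norm_prod_eq_one he i) hσ.1 hσ.2 hc0
          hc1 (fun i => ?_) (fun i => ?_) hab ha
        · rw [← hE, hV, hσc]
        · rw [← hE, hV, hVσ]
      have hs0 := Real.sqrt_nonneg δ
      have hq : √(1 - δ) ^ 2 = 1 - δ := Real.sq_sqrt (by linarith)
      have hr : √(1 - c ^ 2) ^ 2 = 1 - c ^ 2 := Real.sq_sqrt (by nlinarith)
      -- If `√δ ≤ c` the type I error `δ` is used up; otherwise the type I error `c²` is admissible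
      -- and lets the type II error vanish.
      rcases le_total (√δ) c with hcs | hcs
      · have hδs : √(1 - √(1 - δ) ^ 2) = √δ := by rw [hq, sub_sub_cancel]
        have hle : √(1 - c ^ 2) ≤ √(1 - δ) := Real.sqrt_le_sqrt (by
          have := pow_le_pow_left₀ hs0 hcs 2
          rw [Real.sq_sqrt hδ0] at this
          linarith)
        have hg : 0 ≤ √(1 - δ) * c - √δ * √(1 - c ^ 2) := by
          have := mul_le_mul hle hcs hs0 (Real.sqrt_nonneg (1 - δ))
          linarith
        refine ⟨_, hach (a := √(1 - δ)) (b := √δ) (by rw [hq, Real.sq_sqrt hδ0]; ring) hq.ge, e,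
          he, pow_le_pow_left₀ hg ?_ 2⟩
        have hVu := tensorPower_mem_unitaryGroup (mul_diagonal_mem_unitaryGroup hU he) N
        rw [hV]
        have h := le_nu_of_le_norm hVu (q := √(1 - δ)) (c := c)
          (Real.sqrt_le_one.mpr (by linarith)) (Real.sqrt_nonneg _) hc0
          (fun ψ hψ => cos_le_norm_tensorPower hW hVW hθ hD hNθ (by linarith [Real.pi_pos]) hψ)
          (by rw [hδs]; exact hg)
        rwa [hδs] at h
      · refine ⟨_, hach (a := √(1 - c ^ 2)) (b := c) (by rw [hr]; ring) ?_, e, he, ?_⟩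
        · rw [hr]
          have := pow_le_pow_left₀ hc0 hcs 2
          rw [Real.sq_sqrt hδ0] at this
          linarith
        · rw [mul_comm c, sub_self, zero_pow two_ne_zero]
          exact sq_nonneg _

theorem mem_diagonalUnitaries_iff {d : ℕ} {E : Matrix (Fin d) (Fin d) ℂ} :
    E ∈ diagonalUnitaries d ↔ ∃ e : Fin d → ℂ, (∀ i, ‖e i‖ = 1) ∧ E = Matrix.diagonal e := by
  constructor
  · rintro ⟨hE, hdiag⟩
    refine ⟨E.diag, fun i => ?_, hdiag.diagonal_diag.symm⟩
    rw [← hdiag.diagonal_diag, Matrix.mem_unitaryGroup_iff', Matrix.star_eq_conjTranspose,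
      Matrix.diagonal_conjTranspose, Matrix.diagonal_mul_diagonal] at hE
    have h := congrFun (congrFun hE i) i
    rw [Matrix.diagonal_apply_eq, Matrix.one_apply_eq, Pi.star_apply, Complex.star_def,
      Complex.conj_mul'] at h
    have h2 : ‖E.diag i‖ ^ 2 = 1 := by exact_mod_cast h
    exact (pow_eq_one_iff_of_nonneg (norm_nonneg _) two_ne_zero).mp h2
  · rintro ⟨e, he, rfl⟩
    refine ⟨?_, Matrix.isDiag_diagonal e⟩
    have h := mul_diagonal_mem_unitaryGroup (one_mem (Matrix.unitaryGroup (Fin d) ℂ)) he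
    rwa [one_mul] at h

end QuantumCertification

/-- For `d ≥ 2`, `N ≥ 1`, a unitary `U` and `δ ∈ [0, 1]`, the minimized type II error for
certifying `H₀ : P_{1^{⊗N}}` against `H₁ : P_{U^{⊗N}}` exists and equals
`max_{E} ν²_{√(1-δ)}(U^{⊗N} E^{⊗N})` over diagonal unitaries `E` (a maximum that exists). -/
theorem mainTheorem3 (d N : ℕ) (hd : 2 ≤ d) (hN : 1 ≤ N)
    (U : Matrix (Fin d) (Fin d) ℂ) (hU : U ∈ Matrix.unitaryGroup (Fin d) ℂ)
    (δ : ℝ) (hδ : δ ∈ Set.Icc (0 : ℝ) 1) :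
    ∃ p : ℝ,
      QuantumCertification.IsMinTypeIIError
        (QuantumCertification.vonNeumann
          (QuantumCertification.tensorPower (1 : Matrix (Fin d) (Fin d) ℂ) N))
        (QuantumCertification.vonNeumann (QuantumCertification.tensorPower U N)) δ p ∧
      IsGreatest
        ((fun E : Matrix (Fin d) (Fin d) ℂ =>
          QuantumCertification.nu ((Real.sqrt (1 - δ) : ℝ) : ℂ)
            (QuantumCertification.tensorPower U N * QuantumCertification.tensorPower E N) ^ 2) ''
          QuantumCertification.diagonalUnitaries d) p := by
  open QuantumCertification in
  have : Nontrivial (Fin d) := Fin.nontrivial_iff_two_le.mpr hd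
  have : Nonempty (Fin N) := ⟨⟨0, hN⟩⟩
  obtain ⟨p, hp, e, he, hpe⟩ := exists_achievable_le_nu_sq hd hN hU hδ.1 hδ.2
  have hbound : ∀ p ∈ achievableTypeIIErrors (vonNeumann 1) (vonNeumann (tensorPower U N)) δ,
      ∀ e : Fin d → ℂ, (∀ i, ‖e i‖ = 1) → nu ((√(1 - δ) : ℝ) : ℂ)
        (tensorPower U N * tensorPower (Matrix.diagonal e) N) ^ 2 ≤ p := by
    intro p hp e he
    rw [tensorPower_diagonal]
    exact nu_sq_le_of_mem_achievable (tensorPower_mem_unitaryGroup hU N) hδ.1 hδ.2 hp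
      fun i => norm_prod_eq_one he i
  rw [tensorPower_one]
  refine ⟨p, ⟨hp, fun p' hp' => hpe.trans (hbound p' hp' e he)⟩,
    ⟨_, mem_diagonalUnitaries_iff.mpr ⟨e, he, rfl⟩, le_antisymm (hbound p hp e he) hpe⟩, ?_⟩
  rintro _ ⟨E, hE, rfl⟩
  obtain ⟨e', he', rfl⟩ := mem_diagonalUnitaries_iff.mp hE
  exact hbound p hp e' he'
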